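/- **FUP for random Cantor sets.** Setup. For natural numbers $A\le M$ let $\mathbb A(M,A)$ be the set of all $\mathcal A\subset\{0,\dots,M-1\}$ with $\mathrm{Card}(\mathcal A)=A$. Put $B_0=\{0\}$ and, for $j\ge1$, $$B_j=\bigcup_{b\in B_{j-1}}\Big\{b+\frac a{M^j}:a\in\mathcal A(b)\Big\},\qquad \mathcal A(b)\in\mathbb A(M,A),$$ so that $\mathrm{Card}(B_j)=A^j$; put $$\mathcal C_j=\bigcup_{b\in B_j}[b,b+M^{-j}],\qquad \mathcal C=\bigcap_{j\ge1}\mathcal C_j\subset[0,1].$$ The alphabets $\mathcal A(b)$, for $b\in B_{j-1}$ and $j\ge1$, are chosen independently and uniformly: after the points of $B_{j-1}$ are numbered in increasing order, the choices form a point of the probability space $\mathbb A^\infty=\prod_{j\ge1}\mathbb A(M,A)^{A^{j-1}}$ with the product $\mu^\infty$ of the uniform probability measures. For $h>0$ let $\mathcal C(h)$ be the set of real numbers at distance at most $h$ from $\mathcal C$, let $\mathbf 1_{\mathcal C(h)}$ denote multiplication by its indicator function, and let $$\mathcal F_hu(\xi)=\frac1{\sqrt{2\pi h}}\int_{\mathbb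 R}e^{-ix\xi/h}u(x)\,dx .$$ **Theorem.** There is an absolute constant $C>0$, and for every $\varepsilon>0$ there is a constant $C_1=C_1(\varepsilon)>0$ depending only on $\varepsilon$, such that the following holds. Let $0<\delta<\frac23$ with $\varepsilon<\frac\delta2$, and let $M,A\in\mathbb N$ with $M\ge e^{4/\delta}$ and $A=M^\delta$. Then there is a measurable set $\mathfrak G\subset\mathbb A^\infty$ with $$\mu^\infty(\mathbb A^\infty\setminus\mathfrak G)\le C_1e^{-M^\varepsilon/C}$$ such that every Cantor set $\mathcal C$ from $\mathfrak G$ satisfies $$\big\|\mathbf 1_{\mathcal C(h)}\,\mathcal F_h\,\mathbf 1_{\mathcal C(h)}\big\|_{L^2(\mathbb R)\to L^2(\mathbb R)}\le C\,h^{\frac12-\frac34\delta-\varepsilon}\qquad\text{for all }0<h<M^{-8}.$$ -/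

import Mathlib

open MeasureTheory ProbabilityTheory
open scoped ENNReal

noncomputable section

namespace RandomCantor

/-- The space of alphabets: the sets of exactly `A` digits among the `M` digits `0, …, M - 1`. -/
abbrev Alphabet (M A : ℕ) : Type := {s : Finset (Fin M) // s.card = A}

/-- Every set of alphabets is an event. -/
instance (M A : ℕ) : MeasurableSpace (Alphabet M A) := ⊤

instance (M A : ℕ) : DiscreteMeasurableSpace (Alphabet M A) := ⟨fun _ => trivial⟩

/-- The choices made in one generation: the set of the points of generation `j` has `A ^ j`
elements, which are labelled (in increasing order) by the words of length `j` in `A` letters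
(in lexicographic order); each of these points is given one alphabet. -/
abbrev Choices (M A j : ℕ) : Type := (Fin j → Fin A) → Alphabet M A

/-- The sample space: the product over all `j` of the spaces `Choices M A j`, that is, of
`A ^ j`-th powers of the space of alphabets. The coordinate `j` governs the step
from generation `j` to generation `j + 1`. -/
abbrev Sample (M A : ℕ) : Type := (j : ℕ) → Choices M A j

/-- The probability measure on the sample space: the product of the uniform
(normalized counting) measures on the finite spaces `Choices M A j`. -/
def sampleMeasure (M A : ℕ) : Measure (Sample M A) :=
  Measure.infinitePi fun j => (uniformOn Set.univ : Measure (Choices M A j))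

theorem isProbabilityMeasure_sampleMeasure {M A : ℕ} (h : A ≤ M) :
    IsProbabilityMeasure (sampleMeasure M A) := by
  obtain ⟨s, -, hs⟩ := Finset.exists_subset_card_eq
    (s := (Finset.univ : Finset (Fin M))) (n := A) (by simpa using h)
  have : Nonempty (Alphabet M A) := ⟨⟨s, hs⟩⟩
  unfold sampleMeasure
  infer_instance

/-- The `i`-th smallest digit of an alphabet. -/
def digit {M A : ℕ} (s : Alphabet M A) (i : Fin A) : ℕ := (s.1.orderEmbOfFin s.2 i : Fin M)

/-- The point of generation `j` with a given label: the label `w` of length `j + 1` names the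
child, with the digit numbered by the last letter of `w`, of the point labelled by the first `j`
letters of `w`. -/
def point {M A : ℕ} (ω : Sample M A) : (j : ℕ) → (Fin j → Fin A) → ℝ
  | 0, _ => 0
  | j + 1, w =>
    point ω j (Fin.init w) + (digit (ω j (Fin.init w)) (w (Fin.last j)) : ℝ) / (M : ℝ) ^ (j + 1)

/-- The set `B_j` of left endpoints of the intervals of generation `j` (with `B_0 = {0}`). -/
def leftEndpoints {M A : ℕ} (ω : Sample M A) (j : ℕ) : Set ℝ := Set.range (point ω j)

/-- The recursive description of `B_{j+1}`: every `b ∈ B_j` is replaced by the points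
`b + a / M ^ (j + 1)`, with `a` in the alphabet that was given to `b`. -/
theorem leftEndpoints_succ {M A : ℕ} (ω : Sample M A) (j : ℕ) :
    leftEndpoints ω (j + 1) =
      ⋃ w : Fin j → Fin A,
        {x | ∃ a ∈ (ω j w).1, x = point ω j w + ((a : ℕ) : ℝ) / (M : ℝ) ^ (j + 1)} := by
  ext x
  simp only [leftEndpoints, Set.mem_range, Set.mem_iUnion, Set.mem_ofPred_eq]
  constructor
  · rintro ⟨w, rfl⟩
    exact ⟨Fin.init w, _, Finset.orderEmbOfFin_mem _ (ω j (Fin.init w)).2 (w (Fin.last j)), rfl⟩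
  · rintro ⟨w, a, ha, rfl⟩
    have ha' : a ∈ Set.range ((ω j w).1.orderEmbOfFin (ω j w).2) := by
      rw [Finset.range_orderEmbOfFin]; exact ha
    obtain ⟨i, rfl⟩ := ha'
    refine ⟨Fin.snoc w i, ?_⟩
    simp [point, digit]

/-- The union `𝒞_j` of the closed intervals `[b, b + M ^ (-j)]`, `b ∈ B_j`. -/
def cantorStage {M A : ℕ} (ω : Sample M A) (j : ℕ) : Set ℝ :=
  ⋃ b ∈ leftEndpoints ω j, Set.Icc b (b + 1 / (M : ℝ) ^ j)

/-- The random Cantor set `𝒞`. -/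
def cantorSet {M A : ℕ} (ω : Sample M A) : Set ℝ := ⋂ (j : ℕ) (_ : 1 ≤ j), cantorStage ω j

end RandomCantor

/-- The semiclassical Fourier transform, `(2πh)^(-1/2) ∫ exp(-ixξ/h) u(x) dx`, of an integrable
function `u`. -/
def semiclassicalFourier (h : ℝ) (u : ℝ → ℂ) (ξ : ℝ) : ℂ :=
  (1 / Real.sqrt (2 * Real.pi * h) : ℝ) *
    ∫ x : ℝ, Complex.exp (-(Complex.I * (x : ℂ) * (ξ : ℂ) / (h : ℂ))) * u x

/-- The operator `1_X 𝓕_h 1_Y`. It is only used for bounded measurable sets `Y`: then `1_Y u` is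
integrable for every square integrable `u`, so that its Fourier transform is the integral. -/
def localizedFourier (h : ℝ) (X Y : Set ℝ) (u : ℝ → ℂ) : ℝ → ℂ :=
  X.indicator (semiclassicalFourier h (Y.indicator u))

/-- The operator norm on `L²(ℝ)`: the least `c ∈ [0, ∞]` with `‖T u‖ ≤ c ‖u‖` for all square
integrable `u`. -/
def l2OpNorm (T : (ℝ → ℂ) → ℝ → ℂ) : ℝ≥0∞ :=
  sInf {c : ℝ≥0∞ | ∀ u : ℝ → ℂ, MemLp u 2 volume →
    eLpNorm (T u) 2 volume ≤ c * eLpNorm u 2 volume}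

end

/-! Discretization. Choose n with M^(n-1) ≤ 1/h < M^n. Then 𝒞(h) is covered by A^n intervals of
length 5h placed at the points of B_n, and the operator norm is at most 2√h times any ℓ² bound for
the matrix exp(-ixy/h), x, y ∈ B_n (`l2OpNorm_localizedFourier_le`, `prefactor_le`).

Factorization. Put k = ⌊n/2⌋, p = n - k, and write x = x_c + M^(-p) x', y = y_d + M^(-p) y' with
x_c, y_d ∈ B_p. The phase splits into four terms. The coefficient of x'y' is at most 1, so a power
series removes that term at the cost of a factor e. The term x_c y_d is one unimodular number per
block. The two cross terms factor the matrix through the matrices Q_c = exp(-i T x_z x'_w), where z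
runs over B_p, w over the k generations below c, and T = M^(-p)/h. So the norm is at most a constant
times max ‖Q_c‖² (`sum_norm_sq_exp_point_le`).

Randomness. ‖Q_c‖² is the norm of a sum of rank one matrices v v*, one for each wave v with
frequency in the tree below c, and the alphabets of this tree are independent of B_p. The tree is
grown one generation at a time, with the generations not yet drawn replaced by the average over all
digits. The starting matrix is an average over a full grid, bounded by Schur's test and geometric
sums. Each step replaces the mean of a sum of positive semidefinite matrices by the random sum
itself. All summands are at most `gridBound`, which is A^(p+1) up to logarithms, so by matrix
concentration each step costs only a constant factor, once a factor q is included for the tail.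
Hence ‖Q_c‖² is about A^(n/2+O(1)), and for n ≥ 9 the rounding fits into h^(-3δ/4).

Concentration. The digits of an alphabet are drawn without replacement, so the moments tr S^k are
estimated by exchangeable pairs: swapping a chosen digit with an unchosen one preserves the uniform
measure. Antisymmetrizing under the swap, together with a mean value inequality for traces, gives a
recursion for the moments (`sum_trRe_randSum_pow_succ_le`), and Markov's inequality gives the tail
(`card_not_posSemidef_le`). A union bound over c, integer frequencies, generations and scales
finishes the proof. -/

set_option linter.unusedSectionVars false

/-! ### Trace inequalities for positive semidefinite matrices. -/

/-- The real part of the trace. -/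
def Matrix.trRe {Z : Type*} [Fintype Z] (S : Matrix Z Z ℂ) : ℝ := S.trace.re

namespace Matrix

open scoped ComplexOrder

variable {Z : Type*} [Fintype Z]

theorem trRe_add (S T : Matrix Z Z ℂ) : trRe (S + T) = trRe S + trRe T := by
  simp [trRe, trace_add]

theorem trRe_sub (S T : Matrix Z Z ℂ) : trRe (S - T) = trRe S - trRe T := by
  simp [trRe, trace_sub]

theorem trRe_smul (r : ℝ) (S : Matrix Z Z ℂ) : trRe (r • S) = r * trRe S := by
  simp [trRe, trace_smul]

theorem trRe_sum {I : Type*} (s : Finset I) (S : I → Matrix Z Z ℂ) :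
    trRe (∑ i ∈ s, S i) = ∑ i ∈ s, trRe (S i) := by
  simp [trRe, trace_sum]

theorem PosSemidef.trRe_nonneg {S : Matrix Z Z ℂ} (hS : S.PosSemidef) : 0 ≤ trRe S :=
  (Complex.le_def.1 hS.trace_nonneg).1

variable [DecidableEq Z]

/-- A single diagonalization serves all powers at once, so trace inequalities between powers become
scalar inequalities between eigenvalues. -/
theorem PosSemidef.exists_pow_eq {S : Matrix Z Z ℂ} (hS : S.PosSemidef) :
    ∃ (U : Matrix Z Z ℂ) (l : Z → ℝ), U * Uᴴ = 1 ∧ Uᴴ * U = 1 ∧ (∀ i, 0 ≤ l i) ∧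
      ∀ j : ℕ, S ^ j = U * diagonal (fun i => ((l i ^ j : ℝ) : ℂ)) * Uᴴ := by
  have h1 : (hS.1.eigenvectorUnitary : Matrix Z Z ℂ) * (hS.1.eigenvectorUnitary : Matrix Z Z ℂ)ᴴ = 1 :=
    Unitary.coe_mul_star_self _
  have h2 : (hS.1.eigenvectorUnitary : Matrix Z Z ℂ)ᴴ * (hS.1.eigenvectorUnitary : Matrix Z Z ℂ) = 1 :=
    Unitary.coe_star_mul_self _
  refine ⟨(hS.1.eigenvectorUnitary : Matrix Z Z ℂ), hS.1.eigenvalues, h1, h2, hS.eigenvalues_nonneg, fun j => ?_⟩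
  have hsp : S = (hS.1.eigenvectorUnitary : Matrix Z Z ℂ) *
      diagonal (fun i => ((hS.1.eigenvalues i : ℝ) : ℂ)) *
      (hS.1.eigenvectorUnitary : Matrix Z Z ℂ)ᴴ := by
    conv_lhs => rw [hS.1.spectral_theorem, Unitary.conjStarAlgAut_apply]
    rfl
  set U : Matrix Z Z ℂ := (hS.1.eigenvectorUnitary).1
  set l := hS.1.eigenvalues
  induction j with
  | zero =>
    have : diagonal (fun i => ((l i ^ 0 : ℝ) : ℂ)) = (1 : Matrix Z Z ℂ) := by simp
    rw [this, mul_one, h1, pow_zero]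
  | succ j ih =>
    have : diagonal (fun i => ((l i ^ (j + 1) : ℝ) : ℂ)) =
        diagonal (fun i => ((l i ^ j : ℝ) : ℂ)) * diagonal (fun i => ((l i : ℝ) : ℂ)) := by
      rw [diagonal_mul_diagonal]; congr 1; ext i; push_cast; ring
    rw [pow_succ, ih, this]
    conv_lhs => rw [hsp]
    calc _ = U * diagonal (fun i => ((l i ^ j : ℝ) : ℂ)) * (Uᴴ * U) *
          diagonal (fun i => ((l i : ℝ) : ℂ)) * Uᴴ := by simp only [Matrix.mul_assoc]
      _ = _ := by rw [h2]; simp only [Matrix.mul_assoc, Matrix.one_mul]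

/-- In eigenbases of the two outer matrices, the trace is a double sum over pairs of eigenvalues
with nonnegative weights. A pointwise inequality between the eigenvalues is then enough. -/
theorem trRe_mul_diagonal_mul {D U V : Matrix Z Z ℂ} (hD : D.IsHermitian) (x y : Z → ℝ) :
    trRe (D * (U * diagonal (fun i => (x i : ℂ)) * Uᴴ) * D *
        (V * diagonal (fun i => (y i : ℂ)) * Vᴴ)) =
      ∑ a, ∑ b, Complex.normSq ((Vᴴ * D * U) a b) * (x b * y a) := by
  set G := Vᴴ * D * U with hG
  have hGH : Gᴴ = Uᴴ * D * V := by
    simp [hG, conjTranspose_mul, hD.eq, Matrix.mul_assoc]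
  have : (D * (U * diagonal (fun i => (x i : ℂ)) * Uᴴ) * D *
        (V * diagonal (fun i => (y i : ℂ)) * Vᴴ)).trace =
      (G * diagonal (fun i => (x i : ℂ)) * (Gᴴ * diagonal (fun i => (y i : ℂ)))).trace := by
    rw [hGH, hG]
    rw [← Matrix.mul_assoc _ (V * diagonal (fun i => (y i : ℂ))) Vᴴ, trace_mul_comm]
    simp only [Matrix.mul_assoc]
  rw [trRe, this, trace]
  simp only [diag_apply, Matrix.mul_apply (M := G * diagonal _), mul_diagonal, conjTranspose_apply,
    Complex.re_sum]
  refine Finset.sum_congr rfl fun a _ => Finset.sum_congr rfl fun b _ => ?_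
  have : G a b * (x b : ℂ) * (star (G a b) * (y a : ℂ)) =
      ((Complex.normSq (G a b) * (x b * y a) : ℝ) : ℂ) := by
    have := Complex.mul_conj (G a b)
    push_cast
    rw [← this]
    simp only [Complex.star_def]
    ring
  rw [this, Complex.ofReal_re]

/-- For nonnegative scalars x^j y^l ≤ max(x, y)^(j+l) ≤ x^(j+l) + y^(j+l); the double spectral sum
transfers this to matrices that need not commute. -/
theorem trRe_mul_pow_mul_mul_pow_le {D S T : Matrix Z Z ℂ} (hD : D.IsHermitian)
    (hS : S.PosSemidef) (hT : T.PosSemidef) (j l : ℕ) :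
    trRe (D * S ^ j * D * T ^ l) ≤ trRe (D * D * S ^ (j + l)) + trRe (D * D * T ^ (j + l)) := by
  obtain ⟨U, x, hU, -, hx, hSx⟩ := hS.exists_pow_eq
  obtain ⟨V, y, hV, -, hy, hTy⟩ := hT.exists_pow_eq
  have e1 : trRe (D * D * S ^ (j + l)) =
      ∑ a, ∑ b, Complex.normSq ((Vᴴ * D * U) a b) * (x b ^ (j + l) * 1) := by
    rw [← trRe_mul_diagonal_mul hD (fun i => x i ^ (j + l)) (fun _ => 1), ← hSx]
    have : (diagonal fun _ => ((1 : ℝ) : ℂ)) = (1 : Matrix Z Z ℂ) := by simp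
    rw [this, Matrix.mul_one, hV, Matrix.mul_one, trRe, trRe, trace_mul_comm, ← Matrix.mul_assoc,
      trace_mul_comm, Matrix.mul_assoc]
  have e2 : trRe (D * D * T ^ (j + l)) =
      ∑ a, ∑ b, Complex.normSq ((Vᴴ * D * U) a b) * (1 * y a ^ (j + l)) := by
    rw [← trRe_mul_diagonal_mul hD (fun _ => 1) (fun i => y i ^ (j + l)), ← hTy]
    have : (diagonal fun _ => ((1 : ℝ) : ℂ)) = (1 : Matrix Z Z ℂ) := by simp
    rw [this, Matrix.mul_one, hU, Matrix.mul_one]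
  rw [e1, e2, hSx, hTy, trRe_mul_diagonal_mul hD (fun i => x i ^ j) (fun i => y i ^ l),
    ← Finset.sum_add_distrib]
  refine Finset.sum_le_sum fun a _ => ?_
  rw [← Finset.sum_add_distrib]
  refine Finset.sum_le_sum fun b _ => ?_
  rw [← mul_add]
  refine mul_le_mul_of_nonneg_left ?_ (Complex.normSq_nonneg _)
  have hxb := hx b
  have hya := hy a
  rcases le_total (x b) (y a) with h | h
  · calc x b ^ j * y a ^ l ≤ y a ^ j * y a ^ l := by gcongr
      _ = 1 * y a ^ (j + l) := by rw [pow_add, one_mul]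
      _ ≤ _ := by
        have := pow_nonneg hxb (j + l)
        linarith
  · calc x b ^ j * y a ^ l ≤ x b ^ j * x b ^ l := by gcongr
      _ = x b ^ (j + l) * 1 := by rw [pow_add, mul_one]
      _ ≤ _ := by
        have := pow_nonneg hya (j + l)
        linarith

theorem pow_sub_pow_eq_sum (S T : Matrix Z Z ℂ) (k : ℕ) :
    S ^ k - T ^ k = ∑ j ∈ Finset.range k, S ^ j * (S - T) * T ^ (k - 1 - j) := by
  induction k with
  | zero => simp
  | succ k ih =>
    rw [Finset.sum_range_succ']
    have : ∑ j ∈ Finset.range k, S ^ (j + 1) * (S - T) * T ^ (k + 1 - 1 - (j + 1)) =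
        S * (S ^ k - T ^ k) := by
      rw [ih, Finset.mul_sum]
      refine Finset.sum_congr rfl fun j hj => ?_
      rw [pow_succ', show k + 1 - 1 - (j + 1) = k - 1 - j by omega]
      simp only [Matrix.mul_assoc]
    rw [this, pow_zero, Matrix.one_mul, show k + 1 - 1 - 0 = k by omega, pow_succ', pow_succ',
      Matrix.mul_sub, Matrix.sub_mul]
    abel

/-- A mean value inequality for the power function under the trace: telescope S^k - T^k and bound
each of the k mixed terms by the two pure ones. -/
theorem trRe_sub_mul_pow_sub_pow_le {S T : Matrix Z Z ℂ} (hS : S.PosSemidef) (hT : T.PosSemidef)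
    (k : ℕ) :
    trRe ((S - T) * (S ^ k - T ^ k)) ≤
      k * (trRe ((S - T) * (S - T) * S ^ (k - 1)) + trRe ((S - T) * (S - T) * T ^ (k - 1))) := by
  rw [pow_sub_pow_eq_sum, Finset.mul_sum, trRe_sum]
  calc _ ≤ ∑ j ∈ Finset.range k, (trRe ((S - T) * (S - T) * S ^ (k - 1)) +
        trRe ((S - T) * (S - T) * T ^ (k - 1))) := by
        refine Finset.sum_le_sum fun j hj => ?_
        have hj' := Finset.mem_range.1 hj
        have := trRe_mul_pow_mul_mul_pow_le (hS.1.sub hT.1) hS hT j (k - 1 - j)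
        rw [show j + (k - 1 - j) = k - 1 by omega] at this
        simpa only [Matrix.mul_assoc] using this
    _ = _ := by simp [mul_add]

theorem PosSemidef.exists_eq_mul_conjTranspose {P : Matrix Z Z ℂ} (hP : P.PosSemidef) :
    ∃ C : Matrix Z Z ℂ, P = C * Cᴴ := by
  obtain ⟨U, x, hU, hU', hx, h⟩ := hP.exists_pow_eq
  refine ⟨U * diagonal (fun i => ((Real.sqrt (x i) : ℝ) : ℂ)), ?_⟩
  have h1 := h 1
  rw [pow_one] at h1
  rw [h1, conjTranspose_mul, diagonal_conjTranspose, Matrix.mul_assoc, Matrix.mul_assoc,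
    ← Matrix.mul_assoc (diagonal _) (diagonal _) Uᴴ, diagonal_mul_diagonal]
  congr 3
  ext i
  simp only [pow_one, Pi.star_apply, Complex.star_def, Complex.conj_ofReal]
  rw [← Complex.ofReal_mul, Real.mul_self_sqrt (hx i)]

theorem PosSemidef.trRe_mul_nonneg {S P : Matrix Z Z ℂ} (hS : S.PosSemidef) (hP : P.PosSemidef) :
    0 ≤ trRe (S * P) := by
  obtain ⟨C, rfl⟩ := hP.exists_eq_mul_conjTranspose
  have := (hS.conjTranspose_mul_mul_same C).trRe_nonneg
  rwa [trRe, ← Matrix.mul_assoc, trace_mul_comm, ← Matrix.mul_assoc]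

/-- If `0 ≤ S ≤ r` then `S ^ 2 ≤ r S`. -/
theorem PosSemidef.smul_sub_mul_self {S : Matrix Z Z ℂ} {r : ℝ} (hS : S.PosSemidef)
    (h : (r • (1 : Matrix Z Z ℂ) - S).PosSemidef) : (r • S - S * S).PosSemidef := by
  obtain ⟨U, x, hU, hU', hx, hp⟩ := hS.exists_pow_eq
  have h1 := hp 1
  have h2 := hp 2
  have hd : (Uᴴ * (r • (1 : Matrix Z Z ℂ) - S) * U).PosSemidef := h.conjTranspose_mul_mul_same U
  have hd' : Uᴴ * (r • (1 : Matrix Z Z ℂ) - S) * U = diagonal (fun i => ((r - x i : ℝ) : ℂ)) := by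
    rw [Matrix.mul_sub, Matrix.sub_mul]
    nth_rw 1 [← pow_one S]
    rw [h1]
    have : Uᴴ * (U * diagonal (fun i => ((x i ^ 1 : ℝ) : ℂ)) * Uᴴ) * U =
        (Uᴴ * U) * diagonal (fun i => ((x i ^ 1 : ℝ) : ℂ)) * (Uᴴ * U) := by
      simp only [Matrix.mul_assoc]
    rw [this, hU', Matrix.one_mul, Matrix.mul_one, Matrix.mul_smul, Matrix.smul_mul,
      Matrix.mul_one, hU']
    ext i j
    by_cases hij : i = j
    · subst hij; simp
    · simp [hij]
  rw [hd', posSemidef_diagonal_iff] at hd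
  have key : r • S - S * S = U * diagonal (fun i => ((r * x i - x i ^ 2 : ℝ) : ℂ)) * Uᴴ := by
    rw [← pow_two, h2]
    nth_rw 1 [← pow_one S]
    rw [h1, ← Matrix.smul_mul, ← Matrix.mul_smul, ← Matrix.sub_mul, ← Matrix.mul_sub]
    congr 2
    ext i j
    by_cases hij : i = j
    · subst hij; simp
    · simp [hij]
  rw [key]
  refine PosSemidef.mul_mul_conjTranspose_same (posSemidef_diagonal_iff.2 fun i => ?_) U
  have := hd i
  rw [Complex.zero_le_real] at this ⊢
  nlinarith [hx i]

/-- By the parallelogram identity (R - R')² ≤ 2R² + 2R'², and R² ≤ rR, R'² ≤ rR'. This bounds a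
quadratic fluctuation linearly by the summands themselves. -/
theorem trRe_sub_mul_sub_mul_le {R R' P : Matrix Z Z ℂ} {r : ℝ} (hR : R.PosSemidef)
    (hR' : R'.PosSemidef) (h : (r • (1 : Matrix Z Z ℂ) - R).PosSemidef)
    (h' : (r • (1 : Matrix Z Z ℂ) - R').PosSemidef) (hP : P.PosSemidef) :
    trRe ((R - R') * (R - R') * P) ≤ 2 * r * trRe ((R + R') * P) := by
  have e1 := (hR.smul_sub_mul_self h).trRe_mul_nonneg hP
  have e2 := (hR'.smul_sub_mul_self h').trRe_mul_nonneg hP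
  have e3 : 0 ≤ trRe ((R + R') * (R + R') * P) := by
    have h3 := posSemidef_self_mul_conjTranspose (R + R')
    rw [(hR.1.add hR'.1).eq] at h3
    exact h3.trRe_mul_nonneg hP
  simp only [Matrix.sub_mul, Matrix.add_mul, Matrix.mul_sub, Matrix.mul_add, trRe_sub, trRe_add,
    Matrix.smul_mul, trRe_smul] at *
  linarith

/-- If S ≤ t fails, some eigenvalue exceeds t, and its q-th power is one term of the trace. This is
the input to Markov's inequality. -/
theorem PosSemidef.pow_le_trRe_pow {S : Matrix Z Z ℂ} (hS : S.PosSemidef) {t : ℝ} (ht : 0 ≤ t)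
    (q : ℕ) (h : ¬ (t • (1 : Matrix Z Z ℂ) - S).PosSemidef) : t ^ q ≤ trRe (S ^ q) := by
  obtain ⟨U, x, hU, hU', hx, hp⟩ := hS.exists_pow_eq
  have key : t • (1 : Matrix Z Z ℂ) - S = U * diagonal (fun i => ((t - x i : ℝ) : ℂ)) * Uᴴ := by
    nth_rw 1 [← pow_one S]
    rw [hp 1, ← hU, ← Matrix.smul_mul]
    nth_rw 1 [← Matrix.mul_one U]
    rw [← Matrix.mul_smul, ← Matrix.sub_mul, ← Matrix.mul_sub]
    congr 2
    ext i j
    by_cases hij : i = j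
    · subst hij; simp
    · simp [hij]
  have : ∃ i, t < x i := by
    by_contra! hc
    apply h
    rw [key]
    refine PosSemidef.mul_mul_conjTranspose_same (posSemidef_diagonal_iff.2 fun i => ?_) U
    rw [Complex.zero_le_real]
    linarith [hc i]
  obtain ⟨i, hi⟩ := this
  have htr : trRe (S ^ q) = ∑ i, x i ^ q := by
    rw [hp, trRe, trace_mul_comm, ← Matrix.mul_assoc, hU', Matrix.one_mul, trace_diagonal,
      ← Complex.ofReal_sum, Complex.ofReal_re]
  rw [htr]
  calc t ^ q ≤ x i ^ q := by gcongr
    _ ≤ _ := Finset.single_le_sum (f := fun i => x i ^ q) (fun j _ => pow_nonneg (hx j) q)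
      (Finset.mem_univ i)

end Matrix

/-! ### Moments of random matrix sums by exchangeable pairs. -/

namespace RandomCantor

open Matrix
open scoped ComplexOrder

variable {M A : ℕ}

/-- The alphabet obtained by exchanging the roles of two digits. -/
def Alphabet.swap (s : Alphabet M A) (a b : Fin M) : Alphabet M A :=
  ⟨s.1.map (Equiv.swap a b).toEmbedding, by simp [s.2]⟩

theorem Alphabet.mem_swap {s : Alphabet M A} {a b x : Fin M} :
    x ∈ (s.swap a b).1 ↔ Equiv.swap a b x ∈ s.1 := by
  simp only [Alphabet.swap, Finset.mem_map_equiv, Equiv.symm_swap]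

theorem Alphabet.swap_swap (s : Alphabet M A) (a b : Fin M) : (s.swap a b).swap b a = s := by
  ext x
  rw [Alphabet.mem_swap, Alphabet.mem_swap, Equiv.swap_comm b a, Equiv.swap_apply_self]

theorem Alphabet.sum_swap {E : Type*} [AddCommGroup E] {s : Alphabet M A} {a b : Fin M}
    (ha : a ∈ s.1) (hb : b ∉ s.1) (f : Fin M → E) :
    ∑ x ∈ (s.swap a b).1, f x = ∑ x ∈ s.1, f x - f a + f b := by
  rw [Alphabet.swap, Finset.sum_map, ← Finset.sum_erase_add _ _ ha,
    ← Finset.sum_erase_add s.1 f ha]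
  have : ∑ x ∈ s.1.erase a, f ((Equiv.swap a b).toEmbedding x) = ∑ x ∈ s.1.erase a, f x := by
    refine Finset.sum_congr rfl fun x hx => ?_
    have hx' := Finset.mem_erase.1 hx
    have : x ≠ b := fun h => hb (h ▸ hx'.2)
    simp [Equiv.swap_apply_of_ne_of_ne hx'.1 this]
  rw [this]
  simp

variable {I U Z : Type*} [Fintype I] [Fintype U] [DecidableEq U] [Fintype Z] [DecidableEq Z]

/-- Exchangeability of a digit of a random alphabet with a digit outside of it. -/
theorem sum_exchange {u : U} (G : (U → Alphabet M A) → Fin M → Fin M → ℝ) :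
    ∑ s : U → Alphabet M A, ∑ a ∈ (s u).1, ∑ b ∈ (s u).1ᶜ, G s a b =
      ∑ s : U → Alphabet M A, ∑ a ∈ (s u).1, ∑ b ∈ (s u).1ᶜ,
        G (Function.update s u ((s u).swap a b)) b a := by
  have flat : ∀ H : (U → Alphabet M A) → Fin M → Fin M → ℝ,
      ∑ s : U → Alphabet M A, ∑ a ∈ (s u).1, ∑ b ∈ (s u).1ᶜ, H s a b =
        ∑ x : (U → Alphabet M A) × Fin M × Fin M with x.2.1 ∈ (x.1 u).1 ∧ x.2.2 ∉ (x.1 u).1,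
          H x.1 x.2.1 x.2.2 := by
    intro H
    rw [Finset.sum_filter, Fintype.sum_prod_type]
    refine Finset.sum_congr rfl fun s _ => ?_
    rw [Fintype.sum_prod_type, ← Finset.sum_filter_add_sum_filter_not Finset.univ (· ∈ (s u).1)]
    rw [Finset.sum_eq_zero (s := Finset.filter (fun x => ¬ x ∈ (s u).1) Finset.univ), add_zero]
    · rw [show Finset.filter (· ∈ (s u).1) Finset.univ = (s u).1 by ext; simp]
      refine Finset.sum_congr rfl fun a ha => ?_
      rw [← Finset.sum_filter]
      refine Finset.sum_congr ?_ fun _ _ => rfl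
      ext b
      simp [ha]
    · intro x hx
      refine Finset.sum_eq_zero fun y _ => if_neg fun h => (Finset.mem_filter.1 hx).2 h.1
  rw [flat, flat fun s a b => G (Function.update s u ((s u).swap a b)) b a]
  -- Swapping the two digits in the alphabet at u and exchanging their names is an involution of the
  -- index set, so reindexing by it proves the identity.
  let e : (U → Alphabet M A) × Fin M × Fin M → (U → Alphabet M A) × Fin M × Fin M :=
    fun x => (Function.update x.1 u ((x.1 u).swap x.2.1 x.2.2), x.2.2, x.2.1)
  have he : ∀ x, e (e x) = x := by
    rintro ⟨s, a, b⟩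
    simp [e, Alphabet.swap_swap]
  have hmem : ∀ x : (U → Alphabet M A) × Fin M × Fin M,
      x ∈ Finset.filter (fun x : (U → Alphabet M A) × Fin M × Fin M =>
        x.2.1 ∈ (x.1 u).1 ∧ x.2.2 ∉ (x.1 u).1) Finset.univ →
      e x ∈ Finset.filter (fun x : (U → Alphabet M A) × Fin M × Fin M =>
        x.2.1 ∈ (x.1 u).1 ∧ x.2.2 ∉ (x.1 u).1) Finset.univ := by
    rintro ⟨s, a, b⟩ h
    simpa [e, Alphabet.mem_swap] using h
  refine (Finset.sum_nbij' e e hmem hmem (fun x _ => he x) (fun x _ => he x) fun x _ => ?_).symm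
  rfl

/-- The sum of matrices labelled by the digits of the alphabets of a family. -/
noncomputable def randSum (f : I → U) (R : I → Fin M → Matrix Z Z ℂ) (s : U → Alphabet M A) : Matrix Z Z ℂ :=
  ∑ i, ∑ a ∈ (s (f i)).1, R i a

/-- The mean of `randSum`. -/
noncomputable def meanSum (A : ℕ) (R : I → Fin M → Matrix Z Z ℂ) : Matrix Z Z ℂ :=
  ((A : ℝ) / M) • ∑ i, ∑ a, R i a

theorem randSum_posSemidef {f : I → U} {R : I → Fin M → Matrix Z Z ℂ}
    (hR : ∀ i a, (R i a).PosSemidef) (s : U → Alphabet M A) : (randSum f R s).PosSemidef :=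
  posSemidef_sum _ fun i _ => posSemidef_sum _ fun a _ => hR i a

/-- Since f is injective, the alphabet at f i enters only the i-th summand, so a swap changes the
sum by a single difference. -/
theorem randSum_update_swap {f : I → U} (hf : Function.Injective f)
    (R : I → Fin M → Matrix Z Z ℂ) (s : U → Alphabet M A) (i : I) {a b : Fin M}
    (ha : a ∈ (s (f i)).1) (hb : b ∉ (s (f i)).1) :
    randSum f R (Function.update s (f i) ((s (f i)).swap a b)) =
      randSum f R s - (R i a - R i b) := by
  classical
  unfold randSum
  rw [← Finset.sum_erase_add _ _ (Finset.mem_univ i),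
    ← Finset.sum_erase_add (Finset.univ : Finset I) (fun i => ∑ a ∈ (s (f i)).1, R i a)
      (Finset.mem_univ i)]
  have : ∑ j ∈ Finset.univ.erase i,
      ∑ x ∈ (Function.update s (f i) ((s (f i)).swap a b) (f j)).1, R j x =
      ∑ j ∈ Finset.univ.erase i, ∑ x ∈ (s (f j)).1, R j x := by
    refine Finset.sum_congr rfl fun j hj => ?_
    rw [Function.update_of_ne (hf.ne (Finset.ne_of_mem_erase hj))]
  rw [this, Function.update_self, Alphabet.sum_swap ha hb]
  abel

/-- The deviation of a sum over an alphabet from its mean, times M, is a sum of differences between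
a digit inside and a digit outside. This brings the deviation into the form to which `sum_exchange`
applies. -/
theorem sum_sum_compl_sub {E : Type*} [AddCommGroup E] [Module ℝ E] (s : Alphabet M A)
    (g : Fin M → E) :
    ∑ a ∈ s.1, ∑ b ∈ s.1ᶜ, (g a - g b) = (M : ℝ) • ∑ a ∈ s.1, g a - (A : ℝ) • ∑ a, g a := by
  have h1 : (((s.1ᶜ : Finset (Fin M)).card : ℕ) : ℝ) = (M : ℝ) - A := by
    rw [Finset.card_compl, Nat.cast_sub (Finset.card_le_univ _), s.2, Fintype.card_fin]
  have h2 := Finset.sum_add_sum_compl s.1 g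
  rw [← h2]
  simp only [Finset.sum_sub_distrib, Finset.sum_const, s.2, ← Nat.cast_smul_eq_nsmul ℝ, h1,
    ← Finset.smul_sum]
  module

theorem sum_sum_compl_add {E : Type*} [AddCommGroup E] [Module ℝ E] (s : Alphabet M A)
    (g : Fin M → E) :
    ∑ a ∈ s.1, ∑ b ∈ s.1ᶜ, (g a + g b) =
      ((M : ℝ) - 2 * A) • ∑ a ∈ s.1, g a + (A : ℝ) • ∑ a, g a := by
  have h1 : (((s.1ᶜ : Finset (Fin M)).card : ℕ) : ℝ) = (M : ℝ) - A := by
    rw [Finset.card_compl, Nat.cast_sub (Finset.card_le_univ _), s.2, Fintype.card_fin]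
  have h2 := Finset.sum_add_sum_compl s.1 g
  rw [← h2]
  simp only [Finset.sum_add_distrib, Finset.sum_const, s.2, ← Nat.cast_smul_eq_nsmul ℝ, h1,
    ← Finset.smul_sum]
  module

variable {f : I → U} {R : I → Fin M → Matrix Z Z ℂ} {r L : ℝ}

/-- The deviation of one fibre is antisymmetric under the swap, so its correlation with S^k is half
the correlation with S^k - S'^k, where S' is the swapped sum. The mean value inequality bounds this
by (R i a - R i b)² against S^(k-1) and S'^(k-1); a second exchange turns S' back into S. -/
theorem sum_trRe_fibre_mul_pow_le (hf : Function.Injective f) (hr : 0 ≤ r)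
    (hR : ∀ i a, (R i a).PosSemidef)
    (hRr : ∀ i a, (r • (1 : Matrix Z Z ℂ) - R i a).PosSemidef) (i : I) (k : ℕ) :
    ∑ s : U → Alphabet M A, trRe (((M : ℝ) • ∑ a ∈ (s (f i)).1, R i a - (A : ℝ) • ∑ a, R i a) *
        randSum f R s ^ k) ≤
      2 * k * r * ∑ s : U → Alphabet M A,
        trRe (((M : ℝ) • ∑ a ∈ (s (f i)).1, R i a + (A : ℝ) • ∑ a, R i a) *
          randSum f R s ^ (k - 1)) := by
  set S := fun s : U → Alphabet M A => randSum f R s with hS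
  have hSp : ∀ s, (S s).PosSemidef := randSum_posSemidef hR
  have e1 : ∀ s : U → Alphabet M A,
      trRe (((M : ℝ) • ∑ a ∈ (s (f i)).1, R i a - (A : ℝ) • ∑ a, R i a) * S s ^ k) =
        ∑ a ∈ (s (f i)).1, ∑ b ∈ (s (f i)).1ᶜ, trRe ((R i a - R i b) * S s ^ k) := by
    intro s
    rw [← sum_sum_compl_sub]
    simp only [Finset.sum_mul, trRe_sum]
  -- The swap reverses the sign of R i a - R i b and replaces S by S - (R i a - R i b).
  have e2 : ∑ s : U → Alphabet M A, ∑ a ∈ (s (f i)).1, ∑ b ∈ (s (f i)).1ᶜ,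
      trRe ((R i a - R i b) * S s ^ k) =
      ∑ s : U → Alphabet M A, ∑ a ∈ (s (f i)).1, ∑ b ∈ (s (f i)).1ᶜ,
        -trRe ((R i a - R i b) * (S s - (R i a - R i b)) ^ k) := by
    rw [sum_exchange (u := f i) fun s a b => trRe ((R i a - R i b) * S s ^ k)]
    refine Finset.sum_congr rfl fun s _ => Finset.sum_congr rfl fun a ha =>
      Finset.sum_congr rfl fun b hb => ?_
    rw [hS]
    simp only
    rw [randSum_update_swap hf R s i ha (Finset.mem_compl.1 hb), ← neg_sub (R i a) (R i b),
      Matrix.neg_mul]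
    simp [trRe]
  have e3 : ∑ s : U → Alphabet M A, ∑ a ∈ (s (f i)).1, ∑ b ∈ (s (f i)).1ᶜ,
      trRe ((R i a - R i b) * (R i a - R i b) * (S s - (R i a - R i b)) ^ (k - 1)) =
      ∑ s : U → Alphabet M A, ∑ a ∈ (s (f i)).1, ∑ b ∈ (s (f i)).1ᶜ,
        trRe ((R i a - R i b) * (R i a - R i b) * S s ^ (k - 1)) := by
    rw [sum_exchange (u := f i) fun s a b =>
      trRe ((R i a - R i b) * (R i a - R i b) * S s ^ (k - 1))]
    refine Finset.sum_congr rfl fun s _ => Finset.sum_congr rfl fun a ha =>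
      Finset.sum_congr rfl fun b hb => ?_
    rw [hS]
    simp only
    rw [randSum_update_swap hf R s i ha (Finset.mem_compl.1 hb), ← neg_sub (R i a) (R i b),
      neg_mul_neg]
  -- The average of the two expressions in `e2` produces the difference of powers.
  have e4 : 2 * ∑ s : U → Alphabet M A, ∑ a ∈ (s (f i)).1, ∑ b ∈ (s (f i)).1ᶜ,
      trRe ((R i a - R i b) * S s ^ k) ≤
      2 * k * ∑ s : U → Alphabet M A, ∑ a ∈ (s (f i)).1, ∑ b ∈ (s (f i)).1ᶜ,
        trRe ((R i a - R i b) * (R i a - R i b) * S s ^ (k - 1)) := by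
    calc _ = ∑ s : U → Alphabet M A, ∑ a ∈ (s (f i)).1, ∑ b ∈ (s (f i)).1ᶜ,
          trRe ((R i a - R i b) * (S s ^ k - (S s - (R i a - R i b)) ^ k)) := by
          rw [two_mul]
          nth_rw 2 [e2]
          simp only [← Finset.sum_add_distrib, Matrix.mul_sub, trRe_sub]
          rfl
      _ ≤ ∑ s : U → Alphabet M A, ∑ a ∈ (s (f i)).1, ∑ b ∈ (s (f i)).1ᶜ,
          k * (trRe ((R i a - R i b) * (R i a - R i b) * S s ^ (k - 1)) +
            trRe ((R i a - R i b) * (R i a - R i b) * (S s - (R i a - R i b)) ^ (k - 1))) := by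
          refine Finset.sum_le_sum fun s _ => Finset.sum_le_sum fun a ha =>
            Finset.sum_le_sum fun b hb => ?_
          have hT : (S s - (R i a - R i b)).PosSemidef := by
            rw [hS]
            simp only
            rw [← randSum_update_swap hf R s i ha (Finset.mem_compl.1 hb)]
            exact randSum_posSemidef hR _
          have := trRe_sub_mul_pow_sub_pow_le (hSp s) hT k
          rwa [sub_sub_cancel] at this
      _ = _ := by
          simp only [← Finset.mul_sum, Finset.sum_add_distrib]
          rw [e3]
          ring
  have e5 : ∑ s : U → Alphabet M A, ∑ a ∈ (s (f i)).1, ∑ b ∈ (s (f i)).1ᶜ,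
        trRe ((R i a - R i b) * (R i a - R i b) * S s ^ (k - 1)) ≤
      2 * r * ∑ s : U → Alphabet M A,
        trRe (((M : ℝ) • ∑ a ∈ (s (f i)).1, R i a + (A : ℝ) • ∑ a, R i a) * S s ^ (k - 1)) := by
    rw [Finset.mul_sum]
    refine Finset.sum_le_sum fun s _ => ?_
    have hP := (hSp s).pow (k - 1)
    calc _ ≤ ∑ a ∈ (s (f i)).1, ∑ b ∈ (s (f i)).1ᶜ,
          2 * r * trRe ((R i a + R i b) * S s ^ (k - 1)) :=
          Finset.sum_le_sum fun a _ => Finset.sum_le_sum fun b _ =>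
            trRe_sub_mul_sub_mul_le (hR i a) (hR i b) (hRr i a) (hRr i b) hP
      _ = 2 * r * trRe ((((M : ℝ) - 2 * A) • ∑ a ∈ (s (f i)).1, R i a +
            (A : ℝ) • ∑ a, R i a) * S s ^ (k - 1)) := by
          rw [← sum_sum_compl_add]
          simp only [Finset.sum_mul, trRe_sum, Finset.mul_sum]
      _ ≤ _ := by
          refine mul_le_mul_of_nonneg_left ?_ (by positivity)
          -- The term with coefficient -2A has a nonnegative trace and is dropped.
          have : 0 ≤ trRe ((∑ a ∈ (s (f i)).1, R i a) * S s ^ (k - 1)) :=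
            (posSemidef_sum _ fun a _ => hR i a).trRe_mul_nonneg hP
          simp only [Matrix.add_mul, Matrix.smul_mul, trRe_add, trRe_smul]
          have hA : (0 : ℝ) ≤ A := by positivity
          nlinarith [mul_nonneg hA this]
  rw [Finset.sum_congr rfl fun s _ => e1 s]
  change _ ≤ 2 * k * r * ∑ s : U → Alphabet M A,
    trRe (((M : ℝ) • ∑ a ∈ (s (f i)).1, R i a + (A : ℝ) • ∑ a, R i a) * S s ^ (k - 1))
  have hk : (0 : ℝ) ≤ k := by positivity
  have := mul_le_mul_of_nonneg_left e5 hk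
  nlinarith

/-- Summing the fibre bounds over i gives the deviation of the whole sum from its mean, and the mean
is replaced by its upper bound L. The truncated exponents k - 1 are harmless at k = 0, where their
coefficient vanishes. -/
theorem sum_trRe_randSum_pow_succ_le (hM : 0 < M) (hf : Function.Injective f) (hr : 0 ≤ r)
    (hR : ∀ i a, (R i a).PosSemidef)
    (hRr : ∀ i a, (r • (1 : Matrix Z Z ℂ) - R i a).PosSemidef)
    (hmean : (L • (1 : Matrix Z Z ℂ) - meanSum A R).PosSemidef) (k : ℕ) :
    ∑ s : U → Alphabet M A, trRe (randSum f R s ^ (k + 1)) ≤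
      L * ∑ s : U → Alphabet M A, trRe (randSum f R s ^ k) +
      2 * k * r * ∑ s : U → Alphabet M A, (trRe (randSum f R s ^ (k - 1 + 1)) +
        L * trRe (randSum f R s ^ (k - 1))) := by
  have hM' : (0 : ℝ) < M := by exact_mod_cast hM
  have h1 := Finset.sum_le_sum fun i (_ : i ∈ (Finset.univ : Finset I)) =>
    sum_trRe_fibre_mul_pow_le (A := A) hf hr hR hRr i k
  have key : ∀ (s : U → Alphabet M A) (P : Matrix Z Z ℂ),
      ∑ i, trRe (((M : ℝ) • ∑ a ∈ (s (f i)).1, R i a + (A : ℝ) • ∑ a, R i a) * P) =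
        M * (trRe (randSum f R s * P) + trRe (meanSum A R * P)) := by
    intro s P
    rw [← trRe_sum, ← Finset.sum_mul, Finset.sum_add_distrib, ← Finset.smul_sum,
      ← Finset.smul_sum, randSum, meanSum, Matrix.add_mul, trRe_add]
    simp only [Matrix.smul_mul, trRe_smul]
    field_simp
  have key' : ∀ (s : U → Alphabet M A) (P : Matrix Z Z ℂ),
      ∑ i, trRe (((M : ℝ) • ∑ a ∈ (s (f i)).1, R i a - (A : ℝ) • ∑ a, R i a) * P) =
        M * (trRe (randSum f R s * P) - trRe (meanSum A R * P)) := by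
    intro s P
    rw [← trRe_sum, ← Finset.sum_mul, Finset.sum_sub_distrib, ← Finset.smul_sum,
      ← Finset.smul_sum, randSum, meanSum, Matrix.sub_mul, trRe_sub]
    simp only [Matrix.smul_mul, trRe_smul]
    field_simp
  rw [Finset.sum_comm, ← Finset.mul_sum, Finset.sum_comm (s := (Finset.univ : Finset I))] at h1
  simp only [key, key', ← Finset.mul_sum] at h1
  have h2 : ∑ s : U → Alphabet M A,
      (trRe (randSum f R s * randSum f R s ^ k) - trRe (meanSum A R * randSum f R s ^ k)) ≤
      2 * k * r * ∑ s : U → Alphabet M A, (trRe (randSum f R s * randSum f R s ^ (k - 1)) +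
        trRe (meanSum A R * randSum f R s ^ (k - 1))) := by
    refine le_of_mul_le_mul_left ?_ hM'
    linarith
  have hm : ∀ (s : U → Alphabet M A) (j : ℕ),
      trRe (meanSum A R * randSum f R s ^ j) ≤ L * trRe (randSum f R s ^ j) := by
    intro s j
    have := hmean.trRe_mul_nonneg ((randSum_posSemidef (f := f) hR s).pow j)
    rw [Matrix.sub_mul, trRe_sub, Matrix.smul_mul, Matrix.one_mul, trRe_smul] at this
    linarith
  simp only [← pow_succ'] at h2
  have h3 : ∑ s : U → Alphabet M A, trRe (meanSum A R * randSum f R s ^ k) ≤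
      L * ∑ s : U → Alphabet M A, trRe (randSum f R s ^ k) := by
    rw [Finset.mul_sum]; exact Finset.sum_le_sum fun s _ => hm s k
  have h4 : 2 * k * r * ∑ s : U → Alphabet M A, (trRe (randSum f R s ^ (k - 1 + 1)) +
        trRe (meanSum A R * randSum f R s ^ (k - 1))) ≤
      2 * k * r * ∑ s : U → Alphabet M A, (trRe (randSum f R s ^ (k - 1 + 1)) +
        L * trRe (randSum f R s ^ (k - 1))) := by
    refine mul_le_mul_of_nonneg_left ?_ (by positivity)
    exact Finset.sum_le_sum fun s _ => by linarith [hm s (k - 1)]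
  rw [Finset.sum_sub_distrib] at h2
  linarith

/-- Moment bound for a sum of random positive semidefinite matrices. -/
theorem sum_trRe_randSum_pow_le (hM : 0 < M) (hf : Function.Injective f) (hr : 0 ≤ r)
    (hL : 0 ≤ L) (hR : ∀ i a, (R i a).PosSemidef)
    (hRr : ∀ i a, (r • (1 : Matrix Z Z ℂ) - R i a).PosSemidef)
    (hmean : (L • (1 : Matrix Z Z ℂ) - meanSum A R).PosSemidef) {Q : ℕ} (k : ℕ) (hk : k ≤ Q) :
    ∑ s : U → Alphabet M A, trRe (randSum f R s ^ k) ≤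
      (2 * (L + 2 * Q * r)) ^ k * (Fintype.card (U → Alphabet M A) * Fintype.card Z) := by
  set F : ℕ → ℝ := fun k => ∑ s : U → Alphabet M A, trRe (randSum f R s ^ k) with hF
  set B := L + 2 * Q * r with hB
  have hF0 : F 0 = Fintype.card (U → Alphabet M A) * Fintype.card Z := by
    simp [hF, trRe]
  have hF0' : 0 ≤ F 0 := by rw [hF0]; positivity
  have hFn : ∀ j, 0 ≤ F j := fun j =>
    Finset.sum_nonneg fun s _ => ((randSum_posSemidef hR s).pow j).trRe_nonneg
  have hB0 : 0 ≤ B := by positivity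
  have hstep := sum_trRe_randSum_pow_succ_le (f := f) hM hf hr hR hRr hmean
  suffices ∀ k ≤ Q, F k ≤ (2 * B) ^ k * F 0 by
    have h := this k hk
    rwa [hF0] at h
  intro k
  induction k using Nat.strong_induction_on with
  | _ k ih =>
    intro hk
    match k, ih, hk with
    | 0, _, _ => simp
    | 1, _, _ =>
      have := hstep 0
      simp only [Nat.cast_zero, mul_zero, zero_mul, add_zero] at this
      have h1 : F 1 ≤ L * F 0 := by simpa [hF] using this
      have : L ≤ 2 * B := by
        have : 0 ≤ 2 * (Q : ℝ) * r := by positivity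
        linarith
      calc F 1 ≤ L * F 0 := h1
        _ ≤ 2 * B * F 0 := by gcongr
        _ = _ := by ring
    | k + 2, ih, hk =>
      have h1 := ih (k + 1) (by omega) (by omega)
      have h0 := ih k (by omega) (by omega)
      have h := hstep (k + 1)
      simp only [Nat.add_sub_cancel, Finset.sum_add_distrib, ← Finset.mul_sum] at h
      have h' : F (k + 2) ≤ L * F (k + 1) + 2 * ((k + 1 : ℕ) : ℝ) * r * (F (k + 1) + L * F k) := h
      have hkQ : 2 * ((k + 1 : ℕ) : ℝ) * r ≤ 2 * Q * r := by
        have : ((k + 1 : ℕ) : ℝ) ≤ Q := by exact_mod_cast (by omega)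
        gcongr
      have hx : 0 ≤ 2 * (Q : ℝ) * r := by positivity
      have hLB : L ≤ B := by linarith
      have hxB : 2 * (Q : ℝ) * r ≤ B := by linarith
      calc F (k + 2) ≤ L * F (k + 1) + 2 * ((k + 1 : ℕ) : ℝ) * r * (F (k + 1) + L * F k) := h'
        _ ≤ L * F (k + 1) + 2 * Q * r * (F (k + 1) + L * F k) := by
          have := add_nonneg (hFn (k + 1)) (mul_nonneg hL (hFn k))
          gcongr
        _ = B * F (k + 1) + 2 * Q * r * L * F k := by rw [hB]; ring
        _ ≤ B * F (k + 1) + B * B * F k := by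
          have := hFn k
          gcongr
        _ ≤ B * ((2 * B) ^ (k + 1) * F 0) + B * B * ((2 * B) ^ k * F 0) := by gcongr
        -- The two terms contribute 1/2 and 1/4, because each power of B is measured against 2 * B;
        -- this is what the factor 2 in the claim is for.
        _ = (3 / 4) * ((2 * B) ^ (k + 2) * F 0) := by ring
        _ ≤ _ := by
          have : 0 ≤ (2 * B) ^ (k + 2) * F 0 := by positivity
          linarith

/-- Tail bound for a sum of random positive semidefinite matrices. -/
theorem card_not_posSemidef_le (hM : 0 < M) (hf : Function.Injective f) (hr : 0 < r)
    (hL : 0 ≤ L) (hR : ∀ i a, (R i a).PosSemidef)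
    (hRr : ∀ i a, (r • (1 : Matrix Z Z ℂ) - R i a).PosSemidef)
    (hmean : (L • (1 : Matrix Z Z ℂ) - meanSum A R).PosSemidef) (Q : ℕ) (hQ : 0 < Q)
    (T : Finset (U → Alphabet M A))
    (hT : ∀ s ∈ T, ¬ ((4 * (L + 2 * Q * r)) • (1 : Matrix Z Z ℂ) - randSum f R s).PosSemidef) :
    (T.card : ℝ) * 2 ^ Q ≤ Fintype.card (U → Alphabet M A) * Fintype.card Z := by
  have hQ' : (0 : ℝ) < Q := by exact_mod_cast hQ
  have h := sum_trRe_randSum_pow_le (A := A) (f := f) (U := U) hM hf hr.le hL hR hRr hmean Q le_rfl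
  set B := L + 2 * Q * r with hB
  have hB0 : 0 < B := by positivity
  have h1 : (T.card : ℝ) * (4 * B) ^ Q ≤ ∑ s : U → Alphabet M A, trRe (randSum f R s ^ Q) := by
    calc (T.card : ℝ) * (4 * B) ^ Q = ∑ s ∈ T, (4 * B) ^ Q := by simp
      _ ≤ ∑ s ∈ T, trRe (randSum f R s ^ Q) := Finset.sum_le_sum fun s hs =>
          (randSum_posSemidef hR s).pow_le_trRe_pow (by positivity) Q (hT s hs)
      _ ≤ _ := Finset.sum_le_univ_sum_of_nonneg fun s =>
          ((randSum_posSemidef hR s).pow Q).trRe_nonneg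
  have h2 := h1.trans h
  -- The threshold is twice the growth rate of the moments, which leaves the gain 2 ^ Q.
  rw [show 4 * B = 2 * (2 * B) by ring, mul_pow] at h2
  refine le_of_mul_le_mul_left ?_ (pow_pos (show 0 < 2 * B by positivity) Q)
  linarith

end RandomCantor

/-! ### Addresses of points and self-similarity. -/

namespace RandomCantor

open Matrix
open scoped ComplexOrder

variable {M A : ℕ}

theorem digit_lt (s : Alphabet M A) (i : Fin A) : digit s i < M := (s.1.orderEmbOfFin s.2 i).2

theorem digit_injective (s : Alphabet M A) : Function.Injective (digit s) := fun _ _ h =>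
  (s.1.orderEmbOfFin s.2).injective (Fin.ext h)

theorem sum_digit {E : Type*} [AddCommMonoid E] (s : Alphabet M A) (F : ℕ → E) :
    ∑ i, F (digit s i) = ∑ a ∈ s.1, F a := by
  have h : s.1 = Finset.univ.map (s.1.orderEmbOfFin s.2).toEmbedding := by
    ext x
    have := Finset.range_orderEmbOfFin s.1 s.2
    rw [← Finset.mem_coe, ← this]
    simp
  conv_rhs => rw [h]
  rw [Finset.sum_map]
  rfl

/-- The numerator of a point of generation `j` over the denominator `M ^ j`. -/
def pos (ω : Sample M A) : (j : ℕ) → (Fin j → Fin A) → ℕ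
  | 0, _ => 0
  | j + 1, w => M * pos ω j (Fin.init w) + digit (ω j (Fin.init w)) (w (Fin.last j))

theorem point_eq (hM : 0 < M) (ω : Sample M A) (j : ℕ) (w : Fin j → Fin A) :
    point ω j w = pos ω j w / (M : ℝ) ^ j := by
  have hM' : (M : ℝ) ≠ 0 := by positivity
  induction j with
  | zero => simp [point, pos]
  | succ j ih =>
    rw [point, pos, ih]
    push_cast
    field_simp
    ring

theorem pos_lt (ω : Sample M A) (j : ℕ) (w : Fin j → Fin A) :
    pos ω j w < M ^ j := by
  induction j with
  | zero => simp [pos]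
  | succ j ih =>
    rw [pos, pow_succ']
    have h1 := ih (Fin.init w)
    have h2 := digit_lt (ω j (Fin.init w)) (w (Fin.last j))
    nlinarith

theorem pos_injective (hM : 0 < M) (ω : Sample M A) (j : ℕ) : Function.Injective (pos ω j) := by
  induction j with
  | zero => exact fun _ _ _ => Subsingleton.elim _ _
  | succ j ih =>
    intro w w' h
    rw [pos, pos] at h
    have h1 := digit_lt (ω j (Fin.init w)) (w (Fin.last j))
    have h2 := digit_lt (ω j (Fin.init w')) (w' (Fin.last j))
    have e1 : pos ω j (Fin.init w) = pos ω j (Fin.init w') := by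
      have := congrArg (· / M) h
      simpa [Nat.mul_add_div hM, Nat.div_eq_of_lt h1, Nat.div_eq_of_lt h2] using this
    have e2 := ih e1
    rw [e1, e2] at h
    have e3 := digit_injective _ (Nat.add_left_cancel h)
    rw [← Fin.snoc_init_self w, ← Fin.snoc_init_self w', e2, e3]

theorem point_nonneg (ω : Sample M A) (j : ℕ) (w : Fin j → Fin A) : 0 ≤ point ω j w := by
  induction j with
  | zero => simp [point]
  | succ j ih => rw [point]; have := ih (Fin.init w); positivity

theorem point_lt_one (hM : 0 < M) (ω : Sample M A) (j : ℕ) (w : Fin j → Fin A) :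
    point ω j w < 1 := by
  rw [point_eq hM, div_lt_one (by positivity)]
  exact_mod_cast pos_lt ω j w

/-- The part of a sample that governs the descendants of the point labelled by `c`. -/
def shift {p : ℕ} (ω : Sample M A) (c : Fin p → Fin A) : Sample M A :=
  fun j w => ω (p + j) (Fin.append c w)

theorem init_append {p j : ℕ} (c : Fin p → Fin A) (w : Fin (j + 1) → Fin A) :
    Fin.init (n := p + j) (α := fun _ => Fin A) (@Fin.append p (j + 1) (Fin A) c w) =
      Fin.append c (Fin.init (α := fun _ => Fin A) w) := by
  ext i
  refine Fin.addCases (fun i => ?_) (fun i => ?_) i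
  · have : (Fin.castAdd j i).castSucc = Fin.castAdd (j + 1) i := rfl
    simp [Fin.init, this]
  · have : (Fin.natAdd p i).castSucc = Fin.natAdd p i.castSucc := rfl
    simp [Fin.init, this]

/-- The tree below c is a copy, scaled by M^(-p), of the tree of the shifted sample. This gives the
splitting of both variables in the phase. -/
theorem point_append {p : ℕ} (ω : Sample M A) (c : Fin p → Fin A) (j : ℕ) (w : Fin j → Fin A) :
    point ω (p + j) (Fin.append c w) = point ω p c + point (shift ω c) j w / (M : ℝ) ^ p := by
  induction j with
  | zero =>
    have : w = Fin.elim0 := Subsingleton.elim _ _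
    subst this
    simp [point]
  | succ j ih =>
    have hl : @Fin.append p (j + 1) (Fin A) c w (Fin.last (p + j)) = w (Fin.last j) := by
      have : Fin.last (p + j) = Fin.natAdd p (Fin.last j) := rfl
      rw [this, Fin.append_right]
    change point ω (p + j) (Fin.init (α := fun _ => Fin A) (@Fin.append p (j + 1) (Fin A) c w)) +
      (digit (ω (p + j) (Fin.init (α := fun _ => Fin A) (@Fin.append p (j + 1) (Fin A) c w)))
        (@Fin.append p (j + 1) (Fin A) c w (Fin.last (p + j))) : ℝ) / (M : ℝ) ^ (p + j + 1) = _
    rw [init_append, ih, hl, point, add_assoc, add_assoc p j 1, pow_add _ p, add_div, div_div,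
      mul_comm ((M : ℝ) ^ p)]
    rfl

/-! ### Plane waves, grid averages and Schur's test. -/

section Waves

variable {Z : Type*} [Fintype Z] [DecidableEq Z]

/-- The vector of the values of a plane wave at the points `ζ z`. -/
noncomputable def wave (τ : ℝ) (ζ : Z → ℝ) (x : ℝ) : Z → ℂ :=
  fun z => Complex.exp ((-(τ * x * ζ z) : ℝ) * Complex.I)

/-- The mean of the projections on the waves `wave τ ζ x`, where `x` runs through the `M ^ i`
points with denominator `M ^ k` of an interval. -/
noncomputable def gridAvg (M : ℕ) (τ : ℝ) (ζ : Z → ℝ) (k i t : ℕ) : Matrix Z Z ℂ :=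
  ((M : ℝ) ^ i)⁻¹ • ∑ l ∈ Finset.range (M ^ i),
    vecMulVec (wave τ ζ (((t * M ^ i + l : ℕ) : ℝ) / (M : ℝ) ^ k))
      (star (wave τ ζ (((t * M ^ i + l : ℕ) : ℝ) / (M : ℝ) ^ k)))

theorem gridAvg_posSemidef (τ : ℝ) (ζ : Z → ℝ) (k i t : ℕ) :
    (gridAvg M τ ζ k i t).PosSemidef :=
  (posSemidef_sum _ fun _ _ => posSemidef_vecMulVec_self_star _).smul (by positivity)

theorem sum_range_mul {E : Type*} [AddCommMonoid E] (f : ℕ → E) (K N : ℕ) :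
    ∑ l ∈ Finset.range (K * N), f l =
      ∑ a ∈ Finset.range N, ∑ l ∈ Finset.range K, f (a * K + l) := by
  induction N with
  | zero => simp
  | succ N ih => rw [Finset.sum_range_succ, ← ih, Nat.mul_succ, Finset.sum_range_add, mul_comm N K]

/-- A grid interval splits into M intervals of the next generation, one for each digit. Hence
averaging over a uniformly random digit moves one generation up. -/
theorem gridAvg_succ (hM : 0 < M) (τ : ℝ) (ζ : Z → ℝ) (k i t : ℕ) :
    gridAvg M τ ζ k (i + 1) t = (M : ℝ)⁻¹ • ∑ a : Fin M, gridAvg M τ ζ k i (M * t + a) := by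
  have hM' : (M : ℝ) ≠ 0 := by positivity
  rw [Fin.sum_univ_eq_sum_range (fun a => gridAvg M τ ζ k i (M * t + a)) M]
  unfold gridAvg
  rw [← Finset.smul_sum, smul_smul, pow_succ, pow_succ, sum_range_mul, mul_inv, mul_comm]
  congr 1
  refine Finset.sum_congr rfl fun a _ => Finset.sum_congr rfl fun l _ => ?_
  rw [show t * (M ^ i * M) + (a * M ^ i + l) = (M * t + a) * M ^ i + l by ring]

theorem vecMulVec_wave_apply (τ : ℝ) (ζ : Z → ℝ) (x : ℝ) (z z' : Z) :
    vecMulVec (wave τ ζ x) (star (wave τ ζ x)) z z' =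
      Complex.exp ((-(τ * x * (ζ z - ζ z')) : ℝ) * Complex.I) := by
  rw [vecMulVec_apply, Pi.star_apply, wave, wave, Complex.star_def, ← Complex.exp_conj,
    ← Complex.exp_add]
  congr 1
  simp only [map_mul, Complex.conj_ofReal, Complex.conj_I]
  push_cast
  ring

theorem norm_vecMulVec_wave_apply (τ : ℝ) (ζ : Z → ℝ) (x : ℝ) (z z' : Z) :
    ‖vecMulVec (wave τ ζ x) (star (wave τ ζ x)) z z'‖ = 1 := by
  rw [vecMulVec_wave_apply, Complex.norm_exp_ofReal_mul_I]

theorem norm_gridAvg_apply_le_one (hM : 0 < M) (τ : ℝ) (ζ : Z → ℝ) (k i t : ℕ) (z z' : Z) :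
    ‖gridAvg M τ ζ k i t z z'‖ ≤ 1 := by
  have hM' : (0 : ℝ) < M := by exact_mod_cast hM
  rw [gridAvg, Matrix.smul_apply, norm_smul, Matrix.sum_apply]
  have : ‖∑ l ∈ Finset.range (M ^ i),
    vecMulVec (wave τ ζ (((t * M ^ i + l : ℕ) : ℝ) / (M : ℝ) ^ k))
      (star (wave τ ζ (((t * M ^ i + l : ℕ) : ℝ) / (M : ℝ) ^ k))) z z'‖ ≤ (M : ℝ) ^ i := by
    refine (norm_sum_le _ _).trans ?_
    simp only [norm_vecMulVec_wave_apply]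
    simp
  rw [norm_inv, norm_pow, Real.norm_natCast]
  rw [inv_mul_le_iff₀ (by positivity), mul_one]
  exact this

theorem abs_div_two_le_norm_exp_sub_one {θ : ℝ} (h : |θ| ≤ 1) :
    |θ| / 2 ≤ ‖Complex.exp (θ * Complex.I) - 1‖ := by
  have h1 := Real.mul_abs_le_abs_sin (x := θ) (by linarith [Real.pi_gt_three])
  have h2 : |Real.sin θ| ≤ ‖Complex.exp (θ * Complex.I) - 1‖ := by
    refine le_trans (le_of_eq ?_) (Complex.abs_im_le_norm _)
    simp [Complex.exp_ofReal_mul_I_im]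
  have h3 : (1 : ℝ) / 2 ≤ 2 / Real.pi := by
    rw [div_le_div_iff₀ (by norm_num) Real.pi_pos]; linarith [Real.pi_le_four]
  nlinarith [abs_nonneg θ]

/-- An entry is a normalized geometric sum whose ratio has angle θ. Because |θ| ≤ 1, the distance of
the ratio from 1 is at least |θ|/2, so there is no aliasing. -/
theorem norm_gridAvg_apply_mul_le (hM : 0 < M) (τ : ℝ) (ζ : Z → ℝ) (k i t : ℕ) (z z' : Z)
    (h : |τ * (ζ z - ζ z')| ≤ (M : ℝ) ^ k) :
    ‖gridAvg M τ ζ k i t z z'‖ * (|τ * (ζ z - ζ z')| * (M : ℝ) ^ i) ≤ 4 * (M : ℝ) ^ k := by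
  have hM' : (0 : ℝ) < M := by exact_mod_cast hM
  set θ := -(τ * (ζ z - ζ z') / (M : ℝ) ^ k) with hθ
  have habs : |θ| = |τ * (ζ z - ζ z')| / (M : ℝ) ^ k := by
    rw [hθ, abs_neg, abs_div, abs_of_pos (show (0 : ℝ) < (M : ℝ) ^ k by positivity)]
  have hθ1 : |θ| ≤ 1 := by rw [habs, div_le_one (by positivity)]; exact h
  have hsum : ∑ l ∈ Finset.range (M ^ i),
    vecMulVec (wave τ ζ (((t * M ^ i + l : ℕ) : ℝ) / (M : ℝ) ^ k))
      (star (wave τ ζ (((t * M ^ i + l : ℕ) : ℝ) / (M : ℝ) ^ k))) z z' =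
      Complex.exp (θ * Complex.I) ^ (t * M ^ i) *
        ∑ l ∈ Finset.range (M ^ i), Complex.exp (θ * Complex.I) ^ l := by
    rw [Finset.mul_sum]
    refine Finset.sum_congr rfl fun l _ => ?_
    rw [vecMulVec_wave_apply, ← pow_add, ← Complex.exp_nat_mul, hθ]
    congr 1
    push_cast
    ring
  have hn : ∀ m : ℕ, ‖Complex.exp (θ * Complex.I) ^ m‖ = 1 := by
    intro m; rw [norm_pow, Complex.norm_exp_ofReal_mul_I, one_pow]
  have hgeom : ‖∑ l ∈ Finset.range (M ^ i), Complex.exp (θ * Complex.I) ^ l‖ * (|θ| / 2) ≤ 2 := by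
    calc _ ≤ ‖∑ l ∈ Finset.range (M ^ i), Complex.exp (θ * Complex.I) ^ l‖ *
          ‖Complex.exp (θ * Complex.I) - 1‖ := by
          gcongr; exact abs_div_two_le_norm_exp_sub_one hθ1
      _ = ‖Complex.exp (θ * Complex.I) ^ (M ^ i) - 1‖ := by rw [← norm_mul, geom_sum_mul]
      _ ≤ ‖Complex.exp (θ * Complex.I) ^ (M ^ i)‖ + ‖(1 : ℂ)‖ := norm_sub_le _ _
      _ = 2 := by rw [hn, norm_one]; norm_num
  rw [gridAvg, Matrix.smul_apply, norm_smul, Matrix.sum_apply, hsum, norm_mul, hn,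
    one_mul, norm_inv, norm_pow, Real.norm_natCast]
  rw [habs] at hgeom
  set G := ‖∑ l ∈ Finset.range (M ^ i), Complex.exp (θ * Complex.I) ^ l‖
  have h2 : G * |τ * (ζ z - ζ z')| ≤ 4 * (M : ℝ) ^ k := by
    have e : G * (|τ * (ζ z - ζ z')| / (M : ℝ) ^ k / 2) =
      G * |τ * (ζ z - ζ z')| / (2 * (M : ℝ) ^ k) := by field_simp
    rw [e, div_le_iff₀ (by positivity)] at hgeom
    linarith
  calc ((M : ℝ) ^ i)⁻¹ * G * (|τ * (ζ z - ζ z')| * (M : ℝ) ^ i) =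
      G * |τ * (ζ z - ζ z')| := by field_simp
    _ ≤ _ := h2

/-- Schur's test. -/
theorem posSemidef_smul_one_sub_of_sum_norm_le {K : Matrix Z Z ℂ} (hK : K.IsHermitian) {r : ℝ}
    (h : ∀ z, ∑ z', ‖K z z'‖ ≤ r) : (r • (1 : Matrix Z Z ℂ) - K).PosSemidef := by
  have hH : (r • (1 : Matrix Z Z ℂ) - K).IsHermitian := by
    refine IsHermitian.sub ?_ hK
    rw [IsHermitian, conjTranspose_smul]
    simp
  rw [hH.posSemidef_iff_eigenvalues_nonneg]
  intro i
  -- Gershgorin's theorem is applied to r - K, whose off-diagonal entries have the same norms as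
  -- those of K.
  have hev : Module.End.HasEigenvalue (Matrix.toLin' (r • (1 : Matrix Z Z ℂ) - K))
      ((hH.eigenvalues i : ℝ) : ℂ) := by
    refine Module.End.hasEigenvalue_of_hasEigenvector
      (x := (hH.eigenvectorBasis i : Z → ℂ)) ⟨?_, ?_⟩
    · rw [Module.End.mem_eigenspace_iff, Matrix.toLin'_apply, hH.mulVec_eigenvectorBasis]
      rfl
    · intro h0
      have := hH.eigenvectorBasis.orthonormal.ne_zero i
      exact this (by ext z; simpa using congrFun h0 z)
  obtain ⟨z, hz⟩ := eigenvalue_mem_ball hev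
  rw [Metric.mem_closedBall, dist_eq_norm] at hz
  have h1 : ∑ j ∈ Finset.univ.erase z, ‖(r • (1 : Matrix Z Z ℂ) - K) z j‖ =
      ∑ j ∈ Finset.univ.erase z, ‖K z j‖ := by
    refine Finset.sum_congr rfl fun j hj => ?_
    have : z ≠ j := (Finset.ne_of_mem_erase hj).symm
    simp [this]
  rw [h1] at hz
  have h2 := h z
  rw [← Finset.sum_erase_add _ _ (Finset.mem_univ z)] at h2
  have h3 := Complex.abs_re_le_norm (((hH.eigenvalues i : ℝ) : ℂ) -
    (r • (1 : Matrix Z Z ℂ) - K) z z)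
  have h4 := Complex.re_le_norm (K z z)
  simp only [Matrix.sub_apply, Matrix.smul_apply, Matrix.one_apply_eq, Complex.sub_re,
    Complex.ofReal_re, Complex.real_smul, mul_one] at h3
  have h5 := (abs_le.1 h3).1
  simp only [Pi.zero_apply]
  simp only [Matrix.sub_apply, Matrix.smul_apply, Matrix.one_apply_eq, 
    Complex.real_smul, mul_one] at hz h5
  linarith

end Waves

end RandomCantor

/-! ### Bounds for grid averages over the points of a Cantor set. -/

namespace RandomCantor

open Matrix
open scoped ComplexOrder

variable {M A : ℕ}

theorem sum_range_inv_le (N : ℕ) : ∑ d ∈ Finset.range N, 1 / ((d : ℝ) + 1) ≤ 1 + Real.log N := by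
  have h := harmonic_le_one_add_log N
  rw [harmonic] at h
  push_cast at h
  simpa only [one_div] using h

theorem sum_range_inv_abs_sub_le (N a : ℕ) (ha : a < N) :
    ∑ b ∈ Finset.range N, 1 / (|(a : ℝ) - b| + 1) ≤ 2 * (1 + Real.log N) := by
  rw [← Finset.sum_filter_add_sum_filter_not (Finset.range N) (· ≤ a), two_mul]
  have key : ∀ (s : Finset ℕ) (φ : ℕ → ℕ), Set.InjOn φ s → (∀ b ∈ s, φ b < N) →
      (∀ b ∈ s, |(a : ℝ) - b| = φ b) →
      ∑ b ∈ s, 1 / (|(a : ℝ) - b| + 1) ≤ 1 + Real.log N := by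
    intro s φ hinj hlt heq
    refine le_trans ?_ (sum_range_inv_le N)
    calc ∑ b ∈ s, 1 / (|(a : ℝ) - b| + 1) = ∑ b ∈ s, 1 / ((φ b : ℝ) + 1) :=
          Finset.sum_congr rfl fun b hb => by rw [heq b hb]
      _ = ∑ d ∈ s.image φ, 1 / ((d : ℝ) + 1) := (Finset.sum_image (f := fun d : ℕ => 1 / ((d : ℝ) + 1)) hinj).symm
      _ ≤ _ := Finset.sum_le_sum_of_subset_of_nonneg
          (fun d hd => by
            obtain ⟨b, hb, rfl⟩ := Finset.mem_image.1 hd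
            exact Finset.mem_range.2 (hlt b hb)) fun d _ _ => by positivity
  refine add_le_add (key _ (fun b => a - b) ?_ ?_ ?_) (key _ (fun b => b - a) ?_ ?_ ?_)
  · intro b hb c hc h
    simp only [Finset.coe_filter, Finset.mem_range, Set.mem_ofPred_eq] at hb hc h
    omega
  · intro b _
    omega
  · intro b hb
    have h := (Finset.mem_filter.1 hb).2
    have h' : (b : ℝ) ≤ a := by exact_mod_cast h
    rw [Nat.cast_sub h, abs_of_nonneg (by linarith)]
  · intro b hb c hc h
    simp only [Finset.coe_filter, Finset.mem_range, Set.mem_ofPred_eq] at hb hc h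
    omega
  · intro b hb
    have := Finset.mem_range.1 (Finset.mem_filter.1 hb).1
    omega
  · intro b hb
    have h := (Finset.mem_filter.1 hb).2
    have h' : (a : ℝ) ≤ b := by exact_mod_cast (by omega : a ≤ b)
    rw [Nat.cast_sub (by omega), abs_of_nonpos (by linarith)]
    ring

theorem sum_append {E : Type*} [AddCommMonoid E] {p j : ℕ} (F : (Fin (p + j) → Fin A) → E) :
    ∑ u, F u = ∑ c : Fin p → Fin A, ∑ w : Fin j → Fin A, F (Fin.append c w) := by
  rw [← (Fin.appendEquiv p j).sum_comp, Fintype.sum_prod_type]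
  rfl

theorem abs_pos_sub_pos_le (hM : 0 < M) (ω : Sample M A) {i j : ℕ} (w w' : Fin i → Fin A)
    (u u' : Fin j → Fin A) :
    |(pos ω i w : ℝ) - pos ω i w'| - 1 ≤
      (M : ℝ) ^ i * |point ω (i + j) (Fin.append w u) - point ω (i + j) (Fin.append w' u')| := by
  have hM' : (0 : ℝ) < (M : ℝ) ^ i := by positivity
  rw [point_append, point_append, point_eq hM ω i w, point_eq hM ω i w']
  nth_rw 1 [← abs_of_pos hM']
  rw [← abs_mul]
  have h1 := point_nonneg (shift ω w) j u
  have h2 := point_nonneg (shift ω w') j u'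
  have h3 := point_lt_one hM (shift ω w) j u
  have h4 := point_lt_one hM (shift ω w') j u'
  have e : (M : ℝ) ^ i * (pos ω i w / (M : ℝ) ^ i + point (shift ω w) j u / (M : ℝ) ^ i -
      (pos ω i w' / (M : ℝ) ^ i + point (shift ω w') j u' / (M : ℝ) ^ i)) =
      ((pos ω i w : ℝ) - pos ω i w') - (point (shift ω w') j u' - point (shift ω w) j u) := by
    field_simp
    ring
  rw [e]
  have := abs_sub_abs_le_abs_sub ((pos ω i w : ℝ) - pos ω i w')
    (point (shift ω w') j u' - point (shift ω w) j u)
  have h5 : |point (shift ω w') j u' - point (shift ω w) j u| ≤ 1 := abs_le.2 ⟨by linarith, by linarith⟩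
  linarith

/-- The grid interval has length M^(i+1-k) and τ is at least M^(k-1)/2, so the average resolves
separations of order M^(-i), the scale of generation i. The exponent i + 1 instead of i pays for τ
being possibly as small as M^(k-1)/2. -/
theorem norm_gridAvg_point_le (hM : 0 < M) (ω : Sample M A) {i j k t : ℕ} {τ : ℝ}
    (hτ : τ ≤ (M : ℝ) ^ k) (hτ' : (M : ℝ) ^ k ≤ 2 * M * τ) (w w' : Fin i → Fin A)
    (u u' : Fin j → Fin A) :
    ‖gridAvg M τ (point ω (i + j)) k (i + 1) t (Fin.append w u) (Fin.append w' u')‖ ≤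
      24 * (1 / (|(pos ω i w : ℝ) - pos ω i w'| + 1)) := by
  have hM' : (0 : ℝ) < M := by exact_mod_cast hM
  have hMk : (0 : ℝ) < (M : ℝ) ^ k := by positivity
  have hτ0 : 0 < τ := by
    by_contra h
    have : 2 * M * τ ≤ 0 := mul_nonpos_of_nonneg_of_nonpos (by positivity) (not_lt.1 h)
    linarith
  set d := |(pos ω i w : ℝ) - pos ω i w'| with hd
  have hd0 : 0 ≤ d := abs_nonneg _
  have h1 := norm_gridAvg_apply_le_one hM τ (point ω (i + j)) k (i + 1) t (Fin.append w u)
    (Fin.append w' u')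
  rw [mul_one_div, le_div_iff₀ (by positivity)]
  -- For d ≤ 2 the trivial bound gives 3. For d > 2 the decay bound 8 for K (d - 1) and d + 1 ≤ 3 (d
  -- - 1) give 24.
  rcases le_or_gt d 2 with hd2 | hd2
  · nlinarith [norm_nonneg (gridAvg M τ (point ω (i + j)) k (i + 1) t (Fin.append w u)
      (Fin.append w' u'))]
  have h2 := abs_pos_sub_pos_le hM ω w w' u u'
  rw [← hd] at h2
  have hz := point_nonneg ω (i + j) (Fin.append w u)
  have hz' := point_nonneg ω (i + j) (Fin.append w' u')
  have hy := point_lt_one hM ω (i + j) (Fin.append w u)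
  have hy' := point_lt_one hM ω (i + j) (Fin.append w' u')
  have h3 := norm_gridAvg_apply_mul_le hM τ (point ω (i + j)) k (i + 1) t (Fin.append w u)
    (Fin.append w' u') (by
      rw [abs_mul, abs_of_pos hτ0]
      have : |point ω (i + j) (Fin.append w u) - point ω (i + j) (Fin.append w' u')| ≤ 1 :=
        abs_le.2 ⟨by linarith, by linarith⟩
      nlinarith)
  set K := ‖gridAvg M τ (point ω (i + j)) k (i + 1) t (Fin.append w u) (Fin.append w' u')‖
  have hK : 0 ≤ K := norm_nonneg _
  rw [abs_mul, abs_of_pos hτ0] at h3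
  set D := |point ω (i + j) (Fin.append w u) - point ω (i + j) (Fin.append w' u')|
  have h4 : K * (τ * M * (d - 1)) ≤ 4 * (M : ℝ) ^ k := by
    calc K * (τ * M * (d - 1)) ≤ K * (τ * M * ((M : ℝ) ^ i * D)) := by gcongr
      _ = K * (τ * D * (M : ℝ) ^ (i + 1)) := by ring
      _ ≤ _ := h3
  have h5 : K * ((M : ℝ) ^ k * (d - 1)) ≤ 8 * (M : ℝ) ^ k := by
    have : K * ((M : ℝ) ^ k * (d - 1)) ≤ K * (2 * M * τ * (d - 1)) := by
      have : 0 ≤ d - 1 := by linarith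
      gcongr
    linarith
  have h6 : K * (d - 1) ≤ 8 := by
    refine le_of_mul_le_mul_left ?_ hMk
    linarith
  nlinarith

/-- Grouping the points by their ancestors in generation i gives A^j points per group, and the
ancestors are distinct integers below M^i, so what remains is a harmonic sum. -/
theorem sum_norm_gridAvg_point_le (hM : 0 < M) (ω : Sample M A) {i j k t : ℕ} {τ : ℝ}
    (hτ : τ ≤ (M : ℝ) ^ k) (hτ' : (M : ℝ) ^ k ≤ 2 * M * τ) (z : Fin (i + j) → Fin A) :
    ∑ z', ‖gridAvg M τ (point ω (i + j)) k (i + 1) t z z'‖ ≤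
      A ^ j * (48 * (1 + i * Real.log M)) := by
  obtain ⟨⟨w, u⟩, rfl⟩ := (Fin.appendEquiv i j).surjective z
  change ∑ z', ‖gridAvg M τ (point ω (i + j)) k (i + 1) t (Fin.append w u) z'‖ ≤ _
  rw [sum_append]
  calc _ ≤ ∑ w' : Fin i → Fin A, ∑ u' : Fin j → Fin A,
        24 * (1 / (|(pos ω i w : ℝ) - pos ω i w'| + 1)) :=
        Finset.sum_le_sum fun w' _ => Finset.sum_le_sum fun u' _ =>
          norm_gridAvg_point_le hM ω hτ hτ' w w' u u'
    _ = A ^ j * (24 * ∑ w' : Fin i → Fin A, 1 / (|(pos ω i w : ℝ) - pos ω i w'| + 1)) := by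
        simp only [Finset.sum_const, Finset.card_univ, Fintype.card_fun, Fintype.card_fin,
          nsmul_eq_mul, Finset.mul_sum]
        push_cast
        rfl
    _ ≤ A ^ j * (24 * ∑ b ∈ Finset.range (M ^ i), 1 / (|(pos ω i w : ℝ) - b| + 1)) := by
        gcongr
        rw [← Finset.sum_image (s := Finset.univ) (g := pos ω i)
          (f := fun b : ℕ => 1 / (|(pos ω i w : ℝ) - b| + 1)) (pos_injective hM ω i).injOn]
        refine Finset.sum_le_sum_of_subset_of_nonneg (fun b hb => ?_) fun b _ _ => by positivity
        obtain ⟨w', -, rfl⟩ := Finset.mem_image.1 hb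
        exact Finset.mem_range.2 (pos_lt ω i w')
    _ ≤ A ^ j * (24 * (2 * (1 + Real.log ((M ^ i : ℕ) : ℝ)))) := by
        gcongr
        exact sum_range_inv_abs_sub_le _ _ (pos_lt ω i w)
    _ = _ := by push_cast; rw [Real.log_pow]; ring

/-- The bound for the mean of the projections on waves over a grid interval. -/
noncomputable def gridBound (M A p : ℕ) : ℝ := A ^ (p + 1) * (48 * (1 + p * Real.log M))

theorem gridBound_pos (hA : 0 < A) (p : ℕ) : 0 < gridBound M A p := by
  have : 0 ≤ Real.log M := Real.log_natCast_nonneg M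
  unfold gridBound
  positivity

/-- The weight A^g and the row sum bound A^(p-g+1) balance, so the bound does not depend on g: at
every generation the same quantity bounds a single summand. -/
theorem gridBound_sub_gridAvg_posSemidef (hM : 0 < M) (hA : 0 < A) (ω : Sample M A)
    {p k g t : ℕ} {τ : ℝ} (hkp : k ≤ p) (hg : g ≤ k) (hτ : τ ≤ (M : ℝ) ^ k)
    (hτ' : (M : ℝ) ^ k ≤ 2 * M * τ) :
    (gridBound M A p • (1 : Matrix (Fin p → Fin A) (Fin p → Fin A) ℂ) -
      (A : ℝ) ^ g • gridAvg M τ (point ω p) k g t).PosSemidef := by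
  have hA' : (1 : ℝ) ≤ A := by exact_mod_cast hA
  have hlog : 0 ≤ Real.log M := Real.log_natCast_nonneg M
  refine posSemidef_smul_one_sub_of_sum_norm_le ?_ fun z => ?_
  · exact ((gridAvg_posSemidef τ (point ω p) k g t).smul
      (show (0 : ℝ) ≤ (A : ℝ) ^ g by positivity)).1
  simp only [Matrix.smul_apply, norm_smul, norm_pow, Real.norm_natCast, ← Finset.mul_sum]
  cases g with
  | zero =>
    calc _ ≤ (A : ℝ) ^ 0 * ∑ z' : Fin p → Fin A, 1 := by
          gcongr with z'
          exact norm_gridAvg_apply_le_one hM _ _ _ _ _ _ _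
      _ = (A : ℝ) ^ p * 1 := by simp
      _ ≤ (A : ℝ) ^ (p + 1) * (48 * (1 + p * Real.log M)) := by
          gcongr
          · omega
          · nlinarith [mul_nonneg (Nat.cast_nonneg (α := ℝ) p) hlog]
  | succ i =>
    obtain ⟨j, rfl⟩ := Nat.exists_eq_add_of_le (show i ≤ p by omega)
    calc _ ≤ (A : ℝ) ^ (i + 1) * (A ^ j * (48 * (1 + i * Real.log M))) := by
          gcongr
          exact sum_norm_gridAvg_point_le hM ω hτ hτ' z
      _ = (A : ℝ) ^ (i + j + 1) * (48 * (1 + i * Real.log M)) := by ring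
      _ ≤ _ := by
          unfold gridBound
          gcongr
          omega

/-! ### The tree sums that interpolate between the full grid and the Cantor set. -/

variable {Z : Type*} [Fintype Z] [DecidableEq Z]

/-- The sum of the projections on the waves with `x` in the generation `j` of a Cantor set, averaged
over the grid points that descend from it in `g` generations. -/
noncomputable def treeSum (τ : ℝ) (ζ : Z → ℝ) (η : Sample M A) (j g : ℕ) : Matrix Z Z ℂ :=
  (A : ℝ) ^ g • ∑ w : Fin j → Fin A, gridAvg M τ ζ (j + g) g (pos η j w)

/-- The terms of the random sum that leads from generation `j` to generation `j + 1`. -/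
noncomputable def treeTerm (τ : ℝ) (ζ : Z → ℝ) (η : Sample M A) (j g : ℕ) (w : Fin j → Fin A)
    (a : Fin M) : Matrix Z Z ℂ :=
  (A : ℝ) ^ g • gridAvg M τ ζ (j + g + 1) g (M * pos η j w + a)

/-- A uniformly random alphabet contains each digit with probability A/M; together with
`gridAvg_succ` this makes the mean of the next generation equal to the present tree sum. -/
theorem meanSum_treeTerm (hM : 0 < M) (τ : ℝ) (ζ : Z → ℝ) (η : Sample M A) (j g : ℕ) :
    meanSum A (treeTerm τ ζ η j g) = treeSum τ ζ η j (g + 1) := by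
  unfold meanSum treeSum treeTerm
  simp only [← Finset.smul_sum, ← add_assoc, gridAvg_succ hM, smul_smul]
  congr 1
  rw [pow_succ]
  field_simp

theorem sum_snoc {E : Type*} [AddCommMonoid E] {j : ℕ} (F : (Fin (j + 1) → Fin A) → E) :
    ∑ u, F u = ∑ w : Fin j → Fin A, ∑ i : Fin A, F (Fin.snoc (α := fun _ => Fin A) w i) := by
  rw [← (Fin.snocEquiv fun _ : Fin (j + 1) => Fin A).sum_comp, Fintype.sum_prod_type,
    Finset.sum_comm]
  rfl

/-- Given the earlier generations, the next tree sum is a function of the single coordinate p + j,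
in the form required by the concentration bound. Distinct w use distinct entries of that coordinate.
-/
theorem treeSum_succ {p : ℕ} (τ : ℝ) (ζ : Z → ℝ) (ω : Sample M A) (c : Fin p → Fin A) (j g : ℕ) :
    treeSum τ ζ (shift ω c) (j + 1) g =
      randSum (Fin.append c) (treeTerm τ ζ (shift ω c) j g) (ω (p + j)) := by
  unfold treeSum randSum treeTerm
  simp only [← Finset.smul_sum]
  congr 1
  rw [sum_snoc]
  refine Finset.sum_congr rfl fun w _ => ?_
  simp only [pos, Fin.init_snoc, Fin.snoc_last]
  rw [sum_digit (shift ω c j w) fun a =>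
    gridAvg M τ ζ (j + 1 + g) g (M * pos (shift ω c) j w + a)]
  rw [show j + 1 + g = j + g + 1 by ring]
  rfl

/-- The matrix of the waves with frequencies in the generation `j` of a Cantor set. -/
noncomputable def waveMatrix (τ : ℝ) (ζ : Z → ℝ) (η : Sample M A) (j : ℕ) :
    Matrix Z (Fin j → Fin A) ℂ :=
  Matrix.of fun z w => wave τ ζ (point η j w) z

/-- At the end of the interpolation no averaging is left and the tree sum is the Gram type matrix
whose norm is the square of the wanted one. -/
theorem treeSum_zero_right (hM : 0 < M) (τ : ℝ) (ζ : Z → ℝ) (η : Sample M A) (j : ℕ) :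
    treeSum τ ζ η j 0 = waveMatrix τ ζ η j * (waveMatrix τ ζ η j)ᴴ := by
  ext z z'
  simp only [treeSum, gridAvg, pow_zero, inv_one, one_smul, Finset.range_one, Finset.sum_singleton,
    mul_one, add_zero, Matrix.sum_apply, vecMulVec_apply, Matrix.mul_apply, conjTranspose_apply,
    waveMatrix, Matrix.of_apply, Pi.star_apply, point_eq hM]

theorem treeSum_zero_left (τ : ℝ) (ζ : Z → ℝ) (η : Sample M A) (g : ℕ) :
    treeSum τ ζ η 0 g = (A : ℝ) ^ g • gridAvg M τ ζ g g 0 := by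
  simp [treeSum, pos]

end RandomCantor

/-! ### Resampling one generation and the probability of the bad events. -/

theorem MeasureTheory.Measure.infinitePi_map_update {ι : Type*} [DecidableEq ι] {X : ι → Type*}
    [∀ i, MeasurableSpace (X i)] (μ : ∀ i, Measure (X i)) [∀ i, IsProbabilityMeasure (μ i)]
    (i : ι) :
    ((Measure.infinitePi μ).prod (μ i)).map (fun x => Function.update x.1 i x.2) =
      Measure.infinitePi μ := by
  have hm : Measurable fun x : (∀ i, X i) × X i => Function.update x.1 i x.2 :=
    measurable_update'
  refine Measure.eq_infinitePi μ fun s t ht => ?_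
  rw [Measure.map_apply hm (MeasurableSet.pi s.countable_toSet fun j _ => ht j)]
  by_cases hi : i ∈ s
  · have : (fun x : (∀ i, X i) × X i => Function.update x.1 i x.2) ⁻¹' Set.pi s t =
        Set.pi (s.erase i : Finset ι) t ×ˢ t i := by
      ext ⟨x, y⟩
      simp only [Set.mem_preimage, Set.mem_pi, Finset.mem_coe, Set.mem_prod, Finset.mem_erase]
      constructor
      · intro h
        refine ⟨fun j hj => ?_, by simpa using h i hi⟩
        simpa [Function.update_of_ne hj.1] using h j hj.2
      · rintro ⟨h, h'⟩ j hj
        rcases eq_or_ne j i with rfl | hji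
        · simpa using h'
        · simpa [Function.update_of_ne hji] using h j ⟨hji, hj⟩
    rw [this, Measure.prod_prod, Measure.infinitePi_pi μ fun j _ => ht j, Finset.prod_erase_mul _ _ hi]
  · have : (fun x : (∀ i, X i) × X i => Function.update x.1 i x.2) ⁻¹' Set.pi s t =
        Set.pi s t ×ˢ Set.univ := by
      ext ⟨x, y⟩
      simp only [Set.mem_preimage, Set.mem_pi, Finset.mem_coe, Set.mem_prod, Set.mem_univ, and_true]
      refine forall₂_congr fun j hj => ?_
      rw [Function.update_of_ne (fun h : j = i => hi (h ▸ hj))]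
    rw [this, Measure.prod_prod, Measure.infinitePi_pi μ fun j _ => ht j, measure_univ, mul_one]

namespace RandomCantor

open Matrix
open scoped ComplexOrder

variable {M A : ℕ}

theorem nonempty_alphabet (h : A ≤ M) : Nonempty (Alphabet M A) := by
  obtain ⟨s, -, hs⟩ := Finset.exists_subset_card_eq
    (s := (Finset.univ : Finset (Fin M))) (n := A) (by simpa using h)
  exact ⟨⟨s, hs⟩⟩

/-- Redrawing one coordinate independently preserves the product measure, so by Fubini a bound that
holds for every choice of the other coordinates bounds the probability. -/
theorem sampleMeasure_le_of_update (hAM : A ≤ M) (i : ℕ) {B : Set (Sample M A)}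
    (hB : MeasurableSet B) {e : ℝ≥0∞}
    (h : ∀ ω, uniformOn Set.univ {χ : Choices M A i | Function.update ω i χ ∈ B} ≤ e) :
    sampleMeasure M A B ≤ e := by
  have := nonempty_alphabet hAM
  have hm : Measurable fun x : Sample M A × Choices M A i => Function.update x.1 i x.2 :=
    measurable_update'
  have hP := isProbabilityMeasure_sampleMeasure hAM
  rw [sampleMeasure, ← Measure.infinitePi_map_update
      (fun j => (uniformOn Set.univ : Measure (Choices M A j))) i,
    Measure.map_apply hm hB, Measure.prod_apply (hm hB)]
  calc _ ≤ ∫⁻ _ : Sample M A, e ∂(sampleMeasure M A) := lintegral_mono fun ω => h ω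
    _ = e := by simp

/-- An event that depends on finitely many coordinates is the preimage of a set in a finite discrete
space. -/
theorem measurableSet_of_forall_lt {B : Set (Sample M A)} (n : ℕ)
    (h : ∀ ω ω' : Sample M A, (∀ i < n, ω i = ω' i) → ω ∈ B → ω' ∈ B) : MeasurableSet B := by
  let π : Sample M A → (i : Fin n) → Choices M A i := fun ω i => ω i
  have hπ : Measurable π := measurable_pi_lambda _ fun i => measurable_pi_apply (i : ℕ)
  have : B = π ⁻¹' (π '' B) := by
    refine Set.Subset.antisymm (Set.subset_preimage_image _ _) ?_
    rintro ω ⟨ω', hω', he⟩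
    exact h ω' ω (fun i hi => congrFun he ⟨i, hi⟩) hω'
  rw [this]
  exact hπ (MeasurableSet.of_discrete)

theorem point_congr {ω ω' : Sample M A} {j : ℕ} (h : ∀ i < j, ω i = ω' i) :
    point ω j = point ω' j := by
  induction j with
  | zero => rfl
  | succ j ih =>
    funext w
    rw [point, point, ih fun i hi => h i (by omega), h j (by omega)]

theorem pos_congr {ω ω' : Sample M A} {j : ℕ} (h : ∀ i < j, ω i = ω' i) :
    pos ω j = pos ω' j := by
  induction j with
  | zero => rfl
  | succ j ih =>
    funext w
    rw [pos, pos, ih fun i hi => h i (by omega), h j (by omega)]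

theorem shift_congr {p j : ℕ} (c : Fin p → Fin A) {ω ω' : Sample M A}
    (h : ∀ i < p + j, ω i = ω' i) : ∀ i < j, shift ω c i = shift ω' c i := by
  intro i hi
  unfold shift
  rw [h (p + i) (by omega)]

/-- The bound for `treeSum` in generation `j`. -/
noncomputable def treeBound (M A p q j : ℕ) : ℝ := 12 ^ (j + 1) * q * gridBound M A p

/-- The sample satisfies the bound for `treeSum` in generation `j`. -/
def TreeGood {p : ℕ} (q : ℕ) (τ : ℝ) (c : Fin p → Fin A) (ω : Sample M A) (j g : ℕ) : Prop :=
  (treeBound M A p q j • (1 : Matrix (Fin p → Fin A) (Fin p → Fin A) ℂ) -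
    treeSum τ (point ω p) (shift ω c) j g).PosSemidef

theorem treeGood_congr {p q : ℕ} {τ : ℝ} {c : Fin p → Fin A} {ω ω' : Sample M A} {j g : ℕ}
    (h : ∀ i < p + j, ω i = ω' i) : TreeGood q τ c ω j g ↔ TreeGood q τ c ω' j g := by
  unfold TreeGood treeSum
  rw [point_congr (j := p) fun i hi => h i (by omega), pos_congr (shift_congr c h)]

theorem posSemidef_smul_one_sub_mono {Z : Type*} [Fintype Z] [DecidableEq Z]
    {K : Matrix Z Z ℂ} {r r' : ℝ} (h : (r • (1 : Matrix Z Z ℂ) - K).PosSemidef) (hr : r ≤ r') :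
    (r' • (1 : Matrix Z Z ℂ) - K).PosSemidef := by
  have : r' • (1 : Matrix Z Z ℂ) - K = (r • (1 : Matrix Z Z ℂ) - K) + (r' - r) • 1 := by
    rw [sub_smul]; abel
  rw [this]
  exact h.add (PosSemidef.one.smul (sub_nonneg.2 hr))

theorem treeGood_zero (hM : 0 < M) (hA : 0 < A) {p q k : ℕ} (hq : 0 < q) (hkp : k ≤ p) {τ : ℝ}
    (hτ : τ ≤ (M : ℝ) ^ k) (hτ' : (M : ℝ) ^ k ≤ 2 * M * τ) (c : Fin p → Fin A) (ω : Sample M A) :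
    TreeGood q τ c ω 0 k := by
  unfold TreeGood
  rw [treeSum_zero_left]
  refine posSemidef_smul_one_sub_mono
    (gridBound_sub_gridAvg_posSemidef hM hA ω hkp le_rfl hτ hτ') ?_
  have hq' : (1 : ℝ) ≤ q := by exact_mod_cast hq
  have := gridBound_pos (M := M) hA p
  unfold treeBound
  rw [zero_add, pow_one]
  nlinarith [mul_le_mul_of_nonneg_right hq' this.le]

/-- The tail bound sends L to 4 (L + 2qr); the base 12 absorbs both terms, as 4 · 12^(j+1) + 8 ≤
12^(j+2). -/
theorem treeBound_succ_ge (hA : 0 < A) {p q : ℕ} (hq : 0 < q) (j : ℕ) :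
    4 * (treeBound M A p q j + 2 * q * gridBound M A p) ≤ treeBound M A p q (j + 1) := by
  have hq' : (0 : ℝ) < q := by exact_mod_cast hq
  have h := gridBound_pos (M := M) hA p
  have h1 : (1 : ℝ) ≤ 12 ^ (j + 1) := one_le_pow₀ (by norm_num)
  have h2 : 0 < q * gridBound M A p := by positivity
  unfold treeBound
  rw [pow_succ _ (j + 1)]
  nlinarith

/-- The coordinate p + j affects neither the points of generation p nor the tree up to generation j.
With the other coordinates fixed, the first condition therefore just supplies the bound for the
mean, and the tail bound applies with matrices of size A^p. -/
theorem uniformOn_treeGood_le (hM : 0 < M) (hA : 0 < A) (hAM : A ≤ M) {p q j g : ℕ} (hq : 0 < q)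
    (hkp : j + g + 1 ≤ p) {τ : ℝ} (hτ : τ ≤ (M : ℝ) ^ (j + g + 1))
    (hτ' : (M : ℝ) ^ (j + g + 1) ≤ 2 * M * τ) (c : Fin p → Fin A) (ω : Sample M A) :
    uniformOn Set.univ {χ : Choices M A (p + j) |
      TreeGood q τ c (Function.update ω (p + j) χ) j (g + 1) ∧
        ¬ TreeGood q τ c (Function.update ω (p + j) χ) (j + 1) g} ≤
      ENNReal.ofReal ((A : ℝ) ^ p / 2 ^ q) := by
  classical
  have := nonempty_alphabet hAM
  have hupd : ∀ χ : Choices M A (p + j), ∀ i < p + j, Function.update ω (p + j) χ i = ω i :=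
    fun χ i hi => Function.update_of_ne (by omega) _ _
  by_cases hgood : TreeGood q τ c ω j (g + 1)
  swap
  · have : {χ : Choices M A (p + j) |
      TreeGood q τ c (Function.update ω (p + j) χ) j (g + 1) ∧
        ¬ TreeGood q τ c (Function.update ω (p + j) χ) (j + 1) g} = ∅ := by
      ext χ
      simp only [Set.mem_ofPred_eq, Set.mem_empty_iff_false, iff_false, not_and]
      intro h
      exact absurd ((treeGood_congr (hupd χ)).1 h) hgood
    rw [this]
    simp
  set R := treeTerm τ (point ω p) (shift ω c) j g with hR
  set T : Finset (Choices M A (p + j)) := Finset.univ.filter fun χ =>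
    ¬ (treeBound M A p q (j + 1) • (1 : Matrix (Fin p → Fin A) (Fin p → Fin A) ℂ) -
      randSum (Fin.append c) R χ).PosSemidef with hT
  have hset : {χ : Choices M A (p + j) |
      TreeGood q τ c (Function.update ω (p + j) χ) j (g + 1) ∧
        ¬ TreeGood q τ c (Function.update ω (p + j) χ) (j + 1) g} ⊆ T := by
    rintro χ ⟨-, h⟩
    rw [hT, Finset.coe_filter, Set.mem_ofPred_eq]
    refine ⟨Finset.mem_univ _, fun h' => h ?_⟩
    unfold TreeGood
    rw [treeSum_succ, point_congr (j := p) fun i hi => hupd χ i (by omega), Function.update_self]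
    have : treeTerm τ (point ω p) (shift (Function.update ω (p + j) χ) c) j g = R := by
      rw [hR]
      unfold treeTerm
      rw [pos_congr (shift_congr c (hupd χ))]
    rw [this]
    exact h'
  have hinj : Function.Injective (Fin.append c : (Fin j → Fin A) → _) :=
    fun w w' h => by
      ext i
      simpa using congrArg Fin.val (congrFun h (Fin.natAdd p i))
  have hcard := card_not_posSemidef_le (A := A) (f := Fin.append c) (R := R)
    (r := gridBound M A p) (L := treeBound M A p q j) hM hinj (gridBound_pos hA p)
    (by have := gridBound_pos (M := M) hA p; unfold treeBound; positivity)
    (fun w a => (gridAvg_posSemidef _ _ _ _ _).smul (by positivity))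
    (fun w a => gridBound_sub_gridAvg_posSemidef hM hA ω hkp (by omega) hτ hτ')
    (by rw [hR, meanSum_treeTerm hM]; exact hgood) q hq T (by
      intro χ hχ h
      refine (Finset.mem_filter.1 hχ).2 ?_
      exact posSemidef_smul_one_sub_mono h (treeBound_succ_ge hA hq j))
  calc _ ≤ uniformOn Set.univ (T : Set (Choices M A (p + j))) := measure_mono hset
    _ = (T.card : ℝ≥0∞) / Fintype.card (Choices M A (p + j)) := by
      rw [uniformOn_univ, Measure.count_apply_finset]
    _ = ENNReal.ofReal ((T.card : ℝ) / Fintype.card (Choices M A (p + j))) := by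
      rw [ENNReal.ofReal_div_of_pos (by exact_mod_cast Fintype.card_pos), ENNReal.ofReal_natCast,
        ENNReal.ofReal_natCast]
    _ ≤ _ := by
      refine ENNReal.ofReal_le_ofReal ?_
      rw [div_le_div_iff₀ (by exact_mod_cast Fintype.card_pos) (by positivity)]
      refine hcard.trans_eq ?_
      rw [mul_comm]
      simp

/-- The set of the samples for which some wave matrix is large. -/
def badSet (M A p k q : ℕ) : Set (Sample M A) :=
  {ω | ∃ (c : Fin p → Fin A) (τ : ℕ), (τ : ℝ) ≤ (M : ℝ) ^ k ∧ (M : ℝ) ^ k ≤ 2 * M * τ ∧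
    ¬ TreeGood q τ c ω k 0}

theorem measurableSet_badSet (p k q : ℕ) : MeasurableSet (badSet M A p k q) := by
  refine measurableSet_of_forall_lt (p + k) ?_
  rintro ω ω' h ⟨c, τ, h1, h2, h3⟩
  exact ⟨c, τ, h1, h2, fun h4 => h3 ((treeGood_congr h).2 h4)⟩

theorem sampleMeasure_badSet_le (hM : 0 < M) (hA : 0 < A) (hAM : A ≤ M) {p k q : ℕ} (hq : 0 < q)
    (hkp : k ≤ p) :
    sampleMeasure M A (badSet M A p k q) ≤
      ENNReal.ofReal ((A : ℝ) ^ p * (M ^ k + 1) * k * ((A : ℝ) ^ p / 2 ^ q)) := by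
  classical
  let E : (Fin p → Fin A) → ℕ → ℕ → Set (Sample M A) := fun c τ j =>
    {ω | (τ : ℝ) ≤ (M : ℝ) ^ k ∧ (M : ℝ) ^ k ≤ 2 * M * τ ∧
      TreeGood q τ c ω j (k - j) ∧ ¬ TreeGood q τ c ω (j + 1) (k - (j + 1))}
  have hE : ∀ c τ, ∀ j < k, sampleMeasure M A (E c τ j) ≤ ENNReal.ofReal ((A : ℝ) ^ p / 2 ^ q) := by
    intro c τ j hj
    refine sampleMeasure_le_of_update hAM (p + j) ?_ fun ω => ?_
    · refine measurableSet_of_forall_lt (p + (j + 1)) ?_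
      rintro ω ω' h ⟨h1, h2, h3, h4⟩
      exact ⟨h1, h2, (treeGood_congr fun i hi => h i (by omega)).1 h3,
        fun h5 => h4 ((treeGood_congr h).2 h5)⟩
    · by_cases hτ : (τ : ℝ) ≤ (M : ℝ) ^ k ∧ (M : ℝ) ^ k ≤ 2 * M * τ
      · obtain ⟨g, rfl⟩ := Nat.exists_eq_add_of_le (show j + 1 ≤ k by omega)
        have e : j + 1 + g = j + g + 1 := by ring
        rw [e] at hτ hkp
        refine le_trans (measure_mono ?_)
          (uniformOn_treeGood_le hM hA hAM hq hkp hτ.1 hτ.2 c ω)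
        rintro χ ⟨-, -, h3, h4⟩
        rw [show j + 1 + g - j = g + 1 by omega] at h3
        rw [show j + 1 + g - (j + 1) = g by omega] at h4
        exact ⟨h3, h4⟩
      · refine le_trans (measure_mono (t := ∅) ?_) (by simp)
        rintro χ ⟨h1, h2, -⟩
        exact hτ ⟨h1, h2⟩
  have hsub : badSet M A p k q ⊆ ⋃ c ∈ (Finset.univ : Finset (Fin p → Fin A)),
      ⋃ τ ∈ Finset.range (M ^ k + 1), ⋃ j ∈ Finset.range k, E c τ j := by
    rintro ω ⟨c, τ, h1, h2, h3⟩
    -- Generation 0 is always good, so a bad final generation forces some step from good to bad.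
    have : ∃ j < k, TreeGood q τ c ω j (k - j) ∧ ¬ TreeGood q τ c ω (j + 1) (k - (j + 1)) := by
      by_contra! hc
      have : ∀ j ≤ k, TreeGood q τ c ω j (k - j) := by
        intro j
        induction j with
        | zero => exact fun _ => treeGood_zero hM hA hq hkp h1 h2 c ω
        | succ j ih => exact fun hj => hc j (by omega) (ih (by omega))
      exact h3 (by simpa using this k le_rfl)
    obtain ⟨j, hj, hj1, hj2⟩ := this
    simp only [Set.mem_iUnion]
    refine ⟨c, Finset.mem_univ _, τ, Finset.mem_range.2 ?_, j, Finset.mem_range.2 hj, h1, h2,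
      hj1, hj2⟩
    have : τ ≤ M ^ k := by exact_mod_cast h1
    omega
  set e := ENNReal.ofReal ((A : ℝ) ^ p / 2 ^ q) with he
  calc _ ≤ _ := measure_mono hsub
    _ ≤ ∑ c : Fin p → Fin A, ∑ τ ∈ Finset.range (M ^ k + 1), ∑ j ∈ Finset.range k, e := by
        refine (measure_biUnion_finset_le _ _).trans (Finset.sum_le_sum fun c _ => ?_)
        refine (measure_biUnion_finset_le _ _).trans (Finset.sum_le_sum fun τ _ => ?_)
        refine (measure_biUnion_finset_le _ _).trans (Finset.sum_le_sum fun j hj => ?_)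
        exact hE c τ j (Finset.mem_range.1 hj)
    _ = _ := by
        simp only [Finset.sum_const, Finset.card_univ, Finset.card_range, Fintype.card_fun,
          Fintype.card_fin, nsmul_eq_mul]
        rw [he, ENNReal.ofReal_mul (by positivity), ENNReal.ofReal_mul (by positivity),
          ENNReal.ofReal_mul (by positivity), ENNReal.ofReal_natCast,
          ENNReal.ofReal_pow (by positivity), ENNReal.ofReal_natCast]
        have : ENNReal.ofReal ((M : ℝ) ^ k + 1) = ((M ^ k + 1 : ℕ) : ℝ≥0∞) := by
          rw [← ENNReal.ofReal_natCast]; push_cast; rfl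
        rw [this]
        push_cast
        ring

end RandomCantor

/-! ### Operator norms on ℓ². -/

namespace Matrix

open scoped Matrix.Norms.L2Operator

variable {m n : Type*} [Fintype m] [Fintype n] [DecidableEq m] [DecidableEq n]

theorem sum_norm_sq_le_of_l2_opNorm_le {K : Matrix m n ℂ} {c : ℝ} (h : ‖K‖ ≤ c) (v : n → ℂ) :
    ∑ i, ‖∑ j, K i j * v j‖ ^ 2 ≤ c ^ 2 * ∑ j, ‖v j‖ ^ 2 := by
  have h1 := l2_opNorm_mulVec K (WithLp.toLp 2 v)
  have h2 : ‖WithLp.toLp 2 (K *ᵥ v)‖ ≤ c * ‖WithLp.toLp 2 v‖ :=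
    h1.trans (mul_le_mul_of_nonneg_right h (norm_nonneg _))
  have h3 := pow_le_pow_left₀ (norm_nonneg _) h2 2
  rw [mul_pow, EuclideanSpace.norm_sq_eq, EuclideanSpace.norm_sq_eq] at h3
  exact h3

theorem l2_opNorm_le_of_sum_norm_sq_le {K : Matrix m n ℂ} {c : ℝ} (hc : 0 ≤ c)
    (h : ∀ v : n → ℂ, ∑ i, ‖∑ j, K i j * v j‖ ^ 2 ≤ c ^ 2 * ∑ j, ‖v j‖ ^ 2) : ‖K‖ ≤ c := by
  rw [l2_opNorm_def]
  refine ContinuousLinearMap.opNorm_le_bound _ hc fun v => ?_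
  refine le_of_sq_le_sq ?_ (by positivity)
  rw [mul_pow, EuclideanSpace.norm_sq_eq, EuclideanSpace.norm_sq_eq]
  exact h v

theorem l2_opNorm_transpose_le (K : Matrix m n ℂ) : ‖Kᵀ‖ ≤ ‖K‖ := by
  rw [← l2_opNorm_conjTranspose K]
  refine l2_opNorm_le_of_sum_norm_sq_le (norm_nonneg _) fun v => ?_
  have h := sum_norm_sq_le_of_l2_opNorm_le (K := Kᴴ) le_rfl (star v)
  have e1 : ∀ i, ‖∑ j, Kᴴ i j * star v j‖ = ‖∑ j, Kᵀ i j * v j‖ := by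
    intro i
    rw [← norm_star (∑ j, Kᵀ i j * v j), star_sum]
    simp
  refine le_trans (le_of_eq (Finset.sum_congr rfl fun i _ => ?_)) (h.trans (le_of_eq ?_))
  · rw [e1]
  · simp

theorem l2_opNorm_diagonal_le {x : n → ℂ} (hx : ∀ i, ‖x i‖ ≤ 1) :
    ‖(diagonal x : Matrix n n ℂ)‖ ≤ 1 := by
  rw [l2_opNorm_diagonal]
  exact (pi_norm_le_iff_of_nonneg zero_le_one).2 hx

/-- Multiplication of the entries by `exp (-i κ x y)` costs at most the factor `exp κ`. -/
theorem l2_opNorm_mul_exp_le (K : Matrix m n ℂ) {x : m → ℝ} {y : n → ℝ} (hx : ∀ i, |x i| ≤ 1)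
    (hy : ∀ j, |y j| ≤ 1) {κ : ℝ} (hκ : 0 ≤ κ) :
    ‖(Matrix.of fun i j => K i j * Complex.exp ((-(κ * x i * y j) : ℝ) * Complex.I) :
      Matrix m n ℂ)‖ ≤ Real.exp κ * ‖K‖ := by
  let f : ℕ → Matrix m n ℂ := fun l => ((-(κ * Complex.I)) ^ l / (l.factorial : ℂ)) •
    (diagonal (fun i => (x i : ℂ) ^ l) * K * diagonal (fun j => (y j : ℂ) ^ l))
  have hf : ∀ l, ‖f l‖ ≤ κ ^ l / l.factorial * ‖K‖ := by
    intro l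
    have h1 : ‖(diagonal (fun i => (x i : ℂ) ^ l) : Matrix m m ℂ)‖ ≤ 1 :=
      l2_opNorm_diagonal_le fun i => by
        rw [norm_pow, Complex.norm_real]; exact pow_le_one₀ (norm_nonneg _) (hx i)
    have h2 : ‖(diagonal (fun j => (y j : ℂ) ^ l) : Matrix n n ℂ)‖ ≤ 1 :=
      l2_opNorm_diagonal_le fun i => by
        rw [norm_pow, Complex.norm_real]; exact pow_le_one₀ (norm_nonneg _) (hy i)
    have h3 : ‖diagonal (fun i => (x i : ℂ) ^ l) * K * diagonal (fun j => (y j : ℂ) ^ l)‖ ≤ ‖K‖ := by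
      calc _ ≤ ‖diagonal (fun i => (x i : ℂ) ^ l) * K‖ * ‖diagonal (fun j => (y j : ℂ) ^ l)‖ :=
            l2_opNorm_mul _ _
        _ ≤ (‖diagonal (fun i => (x i : ℂ) ^ l)‖ * ‖K‖) * ‖diagonal (fun j => (y j : ℂ) ^ l)‖ := by
            gcongr; exact l2_opNorm_mul _ _
        _ ≤ (1 * ‖K‖) * 1 := by gcongr
        _ = ‖K‖ := by ring
    calc ‖f l‖ ≤ ‖(-(κ * Complex.I)) ^ l / (l.factorial : ℂ)‖ *
          ‖diagonal (fun i => (x i : ℂ) ^ l) * K * diagonal (fun j => (y j : ℂ) ^ l)‖ :=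
          norm_smul_le _ _
      _ ≤ κ ^ l / l.factorial * ‖K‖ := by
          gcongr
          rw [norm_div, norm_pow, norm_neg, norm_mul, Complex.norm_I, mul_one, Complex.norm_real,
            Real.norm_of_nonneg hκ, Complex.norm_natCast]
  have hsum : HasSum (fun l : ℕ => κ ^ l / l.factorial * ‖K‖) (Real.exp κ * ‖K‖) := by
    have := NormedSpace.expSeries_div_hasSum_exp κ
    rw [← Real.exp_eq_exp_ℝ] at this
    exact this.mul_right _
  have hE : HasSum f (Matrix.of fun i j =>
      K i j * Complex.exp ((-(κ * x i * y j) : ℝ) * Complex.I)) := by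
    refine Pi.hasSum.2 fun i => Pi.hasSum.2 fun j => ?_
    have := (NormedSpace.expSeries_div_hasSum_exp
      (((-(κ * x i * y j) : ℝ) : ℂ) * Complex.I)).mul_left (K i j)
    rw [← Complex.exp_eq_exp_ℂ] at this
    have e : (fun l => f l i j) = fun l : ℕ => K i j *
        ((((-(κ * x i * y j) : ℝ) : ℂ) * Complex.I) ^ l / (l.factorial : ℂ)) := by
      funext l
      simp only [f, smul_apply, mul_diagonal, diagonal_mul, smul_eq_mul]
      push_cast
      rw [show -((κ : ℂ) * x i * y j) * Complex.I = (-(κ * Complex.I)) * (x i * y j) by ring,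
        mul_pow, mul_pow]
      ring
    have h2 : HasSum (fun l => f l i j)
        (K i j * Complex.exp (((-(κ * x i * y j) : ℝ) : ℂ) * Complex.I)) := by rw [e]; exact this
    exact h2
  rw [← hE.tsum_eq]
  exact tsum_of_norm_bounded hsum hf

/-- A matrix whose blocks factor through two families of bounded matrices. -/
theorem sum_norm_sq_block_le {α β γ δ : Type*} [Fintype α] [Fintype β] [Fintype γ] [Fintype δ]
    [DecidableEq α] [DecidableEq β] [DecidableEq γ] [DecidableEq δ]
    {P : α → Matrix β γ ℂ} {Q : γ → Matrix α δ ℂ} {φ : α → γ → ℂ} {a b : ℝ}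
    (hP : ∀ i, ‖P i‖ ≤ a) (hQ : ∀ j, ‖Q j‖ ≤ b) (hφ : ∀ i j, ‖φ i j‖ ≤ 1) (v : γ → δ → ℂ) :
    ∑ c, ∑ w, ‖∑ d, ∑ u, P c w d * φ c d * Q d c u * v d u‖ ^ 2 ≤
      (a * b) ^ 2 * ∑ d, ∑ u, ‖v d u‖ ^ 2 := by
  calc _ = ∑ c, ∑ w, ‖∑ d, P c w d * (φ c d * ∑ u, Q d c u * v d u)‖ ^ 2 := by
        simp only [Finset.mul_sum, mul_assoc]
    _ ≤ ∑ c, a ^ 2 * ∑ d, ‖φ c d * ∑ u, Q d c u * v d u‖ ^ 2 :=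
        Finset.sum_le_sum fun c _ => sum_norm_sq_le_of_l2_opNorm_le (hP c) _
    _ ≤ ∑ c, a ^ 2 * ∑ d, ‖∑ u, Q d c u * v d u‖ ^ 2 := by
        gcongr with c _ d _
        rw [norm_mul]
        exact mul_le_of_le_one_left (norm_nonneg _) (hφ c d)
    _ = a ^ 2 * ∑ d, ∑ c, ‖∑ u, Q d c u * v d u‖ ^ 2 := by
        rw [← Finset.mul_sum, Finset.sum_comm]
    _ ≤ a ^ 2 * ∑ d, b ^ 2 * ∑ u, ‖v d u‖ ^ 2 := by
        gcongr with d _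
        exact sum_norm_sq_le_of_l2_opNorm_le (hQ d) _
    _ = _ := by rw [← Finset.mul_sum]; ring

theorem star_dotProduct_self_eq (x : m → ℂ) : star x ⬝ᵥ x = ((∑ i, ‖x i‖ ^ 2 : ℝ) : ℂ) := by
  simp only [dotProduct, Pi.star_apply, Complex.star_def, Complex.conj_mul']
  push_cast
  rfl

open scoped ComplexOrder in
theorem l2_opNorm_le_sqrt {B : Matrix m n ℂ} {c : ℝ} (hc : 0 ≤ c)
    (h : (c • (1 : Matrix m m ℂ) - B * Bᴴ).PosSemidef) : ‖B‖ ≤ Real.sqrt c := by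
  rw [← l2_opNorm_conjTranspose]
  refine l2_opNorm_le_of_sum_norm_sq_le (Real.sqrt_nonneg c) fun v => ?_
  rw [Real.sq_sqrt hc]
  have h1 := (Complex.le_def.1 (h.dotProduct_mulVec_nonneg v)).1
  have hB : star v ᵥ* B = star (Bᴴ *ᵥ v) := by rw [star_mulVec, conjTranspose_conjTranspose]
  rw [Matrix.sub_mulVec, ← Matrix.mulVec_mulVec, dotProduct_sub, Matrix.dotProduct_mulVec _ B, hB,
    smul_mulVec, one_mulVec, dotProduct_smul, star_dotProduct_self_eq,
    star_dotProduct_self_eq, Complex.real_smul, ← Complex.ofReal_mul,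
    ← Complex.ofReal_sub, Complex.ofReal_re, Complex.zero_re] at h1
  exact sub_nonneg.1 h1

end Matrix

/-! ### The discrete uncertainty estimate. -/

namespace RandomCantor

open Matrix
open scoped ComplexOrder Matrix.Norms.L2Operator

variable {M A : ℕ}

/-- Split both points at generation p. The cross terms of the phase give a factorization through the
matrices `Q c`, each of norm at most e√Λ; the term in the two tails costs one more factor e. -/
theorem sum_norm_sq_exp_point_le (hM : 0 < M) (hA : 0 < A) {p k q : ℕ} (hk : 0 < k) (hkp : k ≤ p)
    {ω : Sample M A} (hω : ω ∉ badSet M A p k q) {T : ℝ} (hT : (M : ℝ) ^ (p + k) ≤ M * T)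
    (hT' : T ≤ (M : ℝ) ^ (p + k)) (v : (Fin (p + k) → Fin A) → ℂ) :
    ∑ u, ‖∑ w, Complex.exp ((-(T * point ω (p + k) u * point ω (p + k) w) : ℝ) * Complex.I) *
      v w‖ ^ 2 ≤ (Real.exp 3 * treeBound M A p q k) ^ 2 * ∑ w, ‖v w‖ ^ 2 := by
  have hM' : (0 : ℝ) < M := by exact_mod_cast hM
  have hM1 : (1 : ℝ) ≤ M := by exact_mod_cast hM
  have hΛ : 0 ≤ treeBound M A p q k := by
    have := gridBound_pos (M := M) hA p
    unfold treeBound; positivity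
  set Λ := treeBound M A p q k
  set T₁ := T / (M : ℝ) ^ p with hT₁
  have hT₁M : (M : ℝ) ^ k ≤ M * T₁ := by
    rw [hT₁, ← mul_div_assoc, le_div_iff₀ (by positivity), ← pow_add, add_comm k p]; exact hT
  have hT₁M' : T₁ ≤ (M : ℝ) ^ k := by
    rw [hT₁, div_le_iff₀ (by positivity), ← pow_add, add_comm k p]; exact hT'
  have hT₁1 : 1 ≤ T₁ := by
    obtain ⟨k, rfl⟩ := Nat.exists_eq_succ_of_ne_zero hk.ne'
    rw [Nat.succ_eq_add_one, pow_succ'] at hT₁M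
    exact (one_le_pow₀ hM1).trans (le_of_mul_le_mul_left hT₁M hM')
  -- Rounding to an integer keeps the union bound over frequencies finite. The remainder T₁ - τ lies
  -- in [0, 1) and costs a factor e; as T₁ ≥ 1, rounding at most halves the frequency, whence the
  -- factor 2 in `badSet`.
  set τ := ⌊T₁⌋₊ with hτ
  have hτ1 : (τ : ℝ) ≤ T₁ := Nat.floor_le (by linarith)
  have hτ2 : T₁ < τ + 1 := Nat.lt_floor_add_one T₁
  have hτ3 : (1 : ℝ) ≤ τ := by
    have : 1 ≤ τ := Nat.le_floor (by simpa using hT₁1)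
    exact_mod_cast this
  have hgood : ∀ c : Fin p → Fin A, TreeGood q τ c ω k 0 := by
    intro c
    by_contra h
    refine hω ⟨c, τ, hτ1.trans hT₁M', ?_, h⟩
    nlinarith
  have hpt : ∀ (η : Sample M A) (j : ℕ) (w : Fin j → Fin A), |point η j w| ≤ 1 := fun η j w => by
    rw [abs_of_nonneg (point_nonneg η j w)]; exact (point_lt_one hM η j w).le
  set Q : (Fin p → Fin A) → Matrix (Fin p → Fin A) (Fin k → Fin A) ℂ := fun c =>
    Matrix.of fun z w =>
      Complex.exp ((-(T₁ * point ω p z * point (shift ω c) k w) : ℝ) * Complex.I) with hQ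
  have hQn : ∀ c, ‖Q c‖ ≤ Real.exp 1 * Real.sqrt Λ := by
    intro c
    have h1 : ‖waveMatrix τ (point ω p) (shift ω c) k‖ ≤ Real.sqrt Λ := by
      refine l2_opNorm_le_sqrt hΛ ?_
      rw [← treeSum_zero_right hM]
      exact hgood c
    have h2 := l2_opNorm_mul_exp_le (waveMatrix τ (point ω p) (shift ω c) k)
      (x := point ω p) (y := point (shift ω c) k) (hpt _ _) (hpt _ _)
      (show 0 ≤ T₁ - τ by linarith)
    have h3 : Q c = Matrix.of fun z w => waveMatrix τ (point ω p) (shift ω c) k z w *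
        Complex.exp ((-((T₁ - τ) * point ω p z * point (shift ω c) k w) : ℝ) * Complex.I) := by
      ext z w
      simp only [hQ, waveMatrix, wave, Matrix.of_apply]
      rw [← Complex.exp_add]
      congr 1
      push_cast
      ring
    rw [h3]
    refine h2.trans ?_
    gcongr
    linarith
  have hκ0 : 0 ≤ T₁ / (M : ℝ) ^ p := by positivity
  -- Here k ≤ p is decisive: the phase in the two tails oscillates by at most 1.
  have hκ1 : T₁ / (M : ℝ) ^ p ≤ 1 := by
    rw [div_le_one (by positivity)]
    exact hT₁M'.trans (pow_le_pow_right₀ hM1 hkp)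
  set K : Matrix ((Fin p → Fin A) × (Fin k → Fin A)) ((Fin p → Fin A) × (Fin k → Fin A)) ℂ :=
    Matrix.of fun x y => (Q x.1)ᵀ x.2 y.1 *
      Complex.exp ((-(T * point ω p x.1 * point ω p y.1) : ℝ) * Complex.I) * Q y.1 x.1 y.2 with hK
  have hKn : ‖K‖ ≤ (Real.exp 1 * Real.sqrt Λ) * (Real.exp 1 * Real.sqrt Λ) := by
    refine l2_opNorm_le_of_sum_norm_sq_le (by positivity) fun v => ?_
    have := sum_norm_sq_block_le (P := fun c => (Q c)ᵀ) (Q := Q)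
      (φ := fun c d => Complex.exp ((-(T * point ω p c * point ω p d) : ℝ) * Complex.I))
      (fun c => (l2_opNorm_transpose_le _).trans (hQn c)) hQn
      (fun c d => (Complex.norm_exp_ofReal_mul_I _).le) (fun d u => v (d, u))
    simp only [Fintype.sum_prod_type]
    exact this
  have hEn := (l2_opNorm_mul_exp_le K (x := fun x => point (shift ω x.1) k x.2)
    (y := fun x => point (shift ω x.1) k x.2) (fun x => hpt _ _ _) (fun x => hpt _ _ _) hκ0)
  have hEn' := hEn.trans (show _ ≤ Real.exp 3 * Λ by
    calc _ ≤ Real.exp 1 * ((Real.exp 1 * Real.sqrt Λ) * (Real.exp 1 * Real.sqrt Λ)) := by gcongr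
      _ = (Real.exp 1 * Real.exp 1 * Real.exp 1) * (Real.sqrt Λ * Real.sqrt Λ) := by ring
      _ = _ := by
        rw [Real.mul_self_sqrt hΛ, ← Real.exp_add, ← Real.exp_add]; norm_num)
  have hfin := sum_norm_sq_le_of_l2_opNorm_le hEn' fun x => v (Fin.append x.1 x.2)
  rw [Fintype.sum_prod_type, Fintype.sum_prod_type] at hfin
  rw [sum_append, sum_append]
  refine le_trans (le_of_eq ?_) hfin
  refine Finset.sum_congr rfl fun c _ => Finset.sum_congr rfl fun w _ => ?_
  rw [sum_append, Fintype.sum_prod_type]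
  congr 2
  refine Finset.sum_congr rfl fun d _ => Finset.sum_congr rfl fun u _ => ?_
  congr 1
  simp only [hK, hQ, Matrix.of_apply, Matrix.transpose_apply]
  rw [← Complex.exp_add, ← Complex.exp_add, ← Complex.exp_add, point_append, point_append]
  congr 1
  have : (M : ℂ) ^ p ≠ 0 := by exact_mod_cast (show (M : ℝ) ^ p ≠ 0 by positivity)
  rw [hT₁]
  push_cast
  field_simp
  ring

end RandomCantor

/-! ### From the discrete matrix to the Fourier operator. -/

/-- Superadditivity of the lower integral needs no measurability, so that of the Fourier transform
never has to be discussed. -/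
theorem MeasureTheory.sum_lintegral_le {α ι : Type*} [MeasurableSpace α] (μ : Measure α)
    (s : Finset ι) (f : ι → α → ℝ≥0∞) :
    ∑ i ∈ s, ∫⁻ x, f i x ∂μ ≤ ∫⁻ x, ∑ i ∈ s, f i x ∂μ := by
  classical
  induction s using Finset.induction_on with
  | empty => simp
  | insert i s hi ih =>
    simp only [Finset.sum_insert hi]
    exact (add_le_add_right ih _).trans (le_lintegral_add _ _)

theorem MeasureTheory.setLIntegral_Icc_add (b ℓ : ℝ) (φ : ℝ → ℝ≥0∞) :
    ∫⁻ ξ in Set.Icc b (b + ℓ), φ ξ = ∫⁻ s in Set.Icc 0 ℓ, φ (b + s) := by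
  rw [← lintegral_indicator measurableSet_Icc, ← lintegral_indicator measurableSet_Icc,
    ← lintegral_add_left_eq_self _ b]
  refine lintegral_congr fun s => ?_
  by_cases hs : s ∈ Set.Icc 0 ℓ
  · rw [Set.indicator_of_mem hs, Set.indicator_of_mem]
    exact ⟨by linarith [hs.1], by linarith [hs.2]⟩
  · rw [Set.indicator_of_notMem hs, Set.indicator_of_notMem]
    rintro ⟨h1, h2⟩
    exact hs ⟨by linarith, by linarith⟩

theorem MeasureTheory.enorm_setIntegral_sq_le {ℓ : ℝ} {g : ℝ → ℂ} (hg : Measurable g) :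
    ‖∫ t in Set.Icc 0 ℓ, g t‖ₑ ^ 2 ≤ ENNReal.ofReal ℓ * ∫⁻ t in Set.Icc 0 ℓ, ‖g t‖ₑ ^ 2 := by
  have h1 : ‖∫ t in Set.Icc 0 ℓ, g t‖ₑ ≤ ∫⁻ t in Set.Icc 0 ℓ, ‖g t‖ₑ :=
    enorm_integral_le_lintegral_enorm _
  have h2 := ENNReal.lintegral_mul_le_Lp_mul_Lq (volume.restrict (Set.Icc 0 ℓ))
    (p := 2) (q := 2) (by constructor <;> norm_num) (f := fun t => ‖g t‖ₑ) (g := fun _ => 1)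
    hg.enorm.aemeasurable aemeasurable_const
  simp only [Pi.mul_apply, mul_one, ENNReal.one_rpow, lintegral_const, Measure.restrict_apply_univ,
    Real.volume_Icc, sub_zero, one_mul] at h2
  have h3 : ∀ x : ℝ≥0∞, (x ^ ((1 : ℝ) / 2)) ^ 2 = x := by
    intro x
    rw [← ENNReal.rpow_natCast, ← ENNReal.rpow_mul]
    norm_num
  calc _ ≤ (∫⁻ t in Set.Icc 0 ℓ, ‖g t‖ₑ) ^ 2 := by gcongr
    _ ≤ _ := pow_le_pow_left₀ zero_le h2 2
    _ = _ := by
      rw [mul_pow, h3, h3, mul_comm]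
      congr 1
      refine lintegral_congr fun t => ?_
      rw [← ENNReal.rpow_natCast]
      norm_num

theorem semiclassicalFourier_eq (h : ℝ) (u : ℝ → ℂ) (ξ : ℝ) :
    semiclassicalFourier h u ξ = ((1 / Real.sqrt (2 * Real.pi * h) : ℝ) : ℂ) *
      ∫ x : ℝ, Complex.exp ((-(h⁻¹ * ξ * x) : ℝ) * Complex.I) * u x := by
  unfold semiclassicalFourier
  congr 2
  funext x
  congr 2
  push_cast
  ring

section Covering

variable {ι : Type*} [Fintype ι] {x : ι → ℝ} {h a ℓ E : ℝ}

/-- Translating rows by s and columns by t multiplies the matrix by unimodular row and column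
factors, so the ℓ² bound is unchanged. -/
theorem sum_enorm_sq_exp_le (hE0 : 0 ≤ E)
    (hE : ∀ v : ι → ℂ, ∑ i, ‖∑ j, Complex.exp ((-(h⁻¹ * x i * x j) : ℝ) * Complex.I) * v j‖ ^ 2 ≤
      E ^ 2 * ∑ j, ‖v j‖ ^ 2) (s t : ℝ) (v : ι → ℂ) :
    ∑ i, ‖∑ j, Complex.exp ((-(h⁻¹ * (x i + s) * (x j + t)) : ℝ) * Complex.I) * v j‖ₑ ^ 2 ≤
      ENNReal.ofReal E ^ 2 * ∑ j, ‖v j‖ₑ ^ 2 := by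
  have h1 := hE fun j => Complex.exp ((-(h⁻¹ * s * x j) : ℝ) * Complex.I) * v j
  have e : ∀ i, ‖∑ j, Complex.exp ((-(h⁻¹ * (x i + s) * (x j + t)) : ℝ) * Complex.I) * v j‖ =
      ‖∑ j, Complex.exp ((-(h⁻¹ * x i * x j) : ℝ) * Complex.I) *
        (Complex.exp ((-(h⁻¹ * s * x j) : ℝ) * Complex.I) * v j)‖ := by
    intro i
    rw [← one_mul ‖∑ j, Complex.exp ((-(h⁻¹ * x i * x j) : ℝ) * Complex.I) *
        (Complex.exp ((-(h⁻¹ * s * x j) : ℝ) * Complex.I) * v j)‖,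
      ← Complex.norm_exp_ofReal_mul_I (-(h⁻¹ * (x i + s) * t)), ← norm_mul, Finset.mul_sum]
    congr 1
    refine Finset.sum_congr rfl fun j _ => ?_
    rw [← mul_assoc, ← mul_assoc, ← Complex.exp_add, ← Complex.exp_add]
    congr 2
    push_cast
    ring
  simp only [← e, norm_mul, Complex.norm_exp_ofReal_mul_I, one_mul] at h1
  have h2 := ENNReal.ofReal_le_ofReal h1
  rw [ENNReal.ofReal_mul (by positivity), ENNReal.ofReal_pow hE0,
    ENNReal.ofReal_sum_of_nonneg fun _ _ => by positivity,
    ENNReal.ofReal_sum_of_nonneg fun _ _ => by positivity] at h2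
  simpa only [ENNReal.ofReal_pow (norm_nonneg _), ofReal_norm] using h2

open Classical in
/-- The number of the intervals `[x i + a, x i + a + ℓ]` that contain a point. -/
noncomputable def coverCount (x : ι → ℝ) (a ℓ : ℝ) (y : ℝ) : ℝ :=
  ∑ i, (Set.Icc (x i + a) (x i + a + ℓ)).indicator 1 y

/-- The partition of unity subordinate to the intervals `[x i + a, x i + a + ℓ]`. -/
noncomputable def coverWeight (x : ι → ℝ) (a ℓ : ℝ) (i : ι) (y : ℝ) : ℝ :=
  (Set.Icc (x i + a) (x i + a + ℓ)).indicator 1 y / coverCount x a ℓ y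

theorem measurable_coverWeight (i : ι) : Measurable (coverWeight x a ℓ i) := by
  unfold coverWeight coverCount
  refine Measurable.div (measurable_one.indicator measurableSet_Icc) ?_
  exact Finset.measurable_sum _ fun j _ => measurable_one.indicator measurableSet_Icc

theorem coverCount_nonneg (y : ℝ) : 0 ≤ coverCount x a ℓ y :=
  Finset.sum_nonneg fun _ _ => Set.indicator_nonneg (fun _ _ => zero_le_one) _

theorem one_le_coverCount {y : ℝ} (hy : y ∈ ⋃ i, Set.Icc (x i + a) (x i + a + ℓ)) :
    1 ≤ coverCount x a ℓ y := by
  obtain ⟨i, hi⟩ := Set.mem_iUnion.1 hy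
  unfold coverCount
  calc (1 : ℝ) = (Set.Icc (x i + a) (x i + a + ℓ)).indicator 1 y := by
        rw [Set.indicator_of_mem hi]; rfl
    _ ≤ _ := Finset.single_le_sum
        (f := fun i => (Set.Icc (x i + a) (x i + a + ℓ)).indicator (1 : ℝ → ℝ) y)
        (fun j _ => Set.indicator_nonneg (fun _ _ => zero_le_one) _) (Finset.mem_univ i)

theorem sum_coverWeight {y : ℝ} (hy : y ∈ ⋃ i, Set.Icc (x i + a) (x i + a + ℓ)) :
    ∑ i, coverWeight x a ℓ i y = 1 := by
  have := one_le_coverCount hy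
  unfold coverWeight
  rw [← Finset.sum_div]
  exact div_self (by change coverCount x a ℓ y ≠ 0; linarith)

theorem coverWeight_nonneg (i : ι) (y : ℝ) : 0 ≤ coverWeight x a ℓ i y :=
  div_nonneg (Set.indicator_nonneg (fun _ _ => zero_le_one) _) (coverCount_nonneg y)

theorem coverWeight_of_notMem {i : ι} {y : ℝ} (hy : y ∉ Set.Icc (x i + a) (x i + a + ℓ)) :
    coverWeight x a ℓ i y = 0 := by
  rw [coverWeight, Set.indicator_of_notMem hy, zero_div]

theorem sum_coverWeight_le_one (y : ℝ) : ∑ i, coverWeight x a ℓ i y ≤ 1 := by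
  by_cases hy : y ∈ ⋃ i, Set.Icc (x i + a) (x i + a + ℓ)
  · exact (sum_coverWeight hy).le
  · rw [Finset.sum_eq_zero fun i _ => coverWeight_of_notMem fun h => hy (Set.mem_iUnion.2 ⟨i, h⟩)]
    exact zero_le_one

theorem coverWeight_le_one (i : ι) (y : ℝ) : coverWeight x a ℓ i y ≤ 1 :=
  (Finset.single_le_sum (f := fun i => coverWeight x a ℓ i y) (fun j _ => coverWeight_nonneg j y)
    (Finset.mem_univ i)).trans (sum_coverWeight_le_one y)

theorem sum_enorm_coverWeight_mul_sq_le (y : ℝ) (z : ℂ) :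
    ∑ i, ‖(coverWeight x a ℓ i y : ℂ) * z‖ₑ ^ 2 ≤ ‖z‖ₑ ^ 2 := by
  have h1 : ∑ i, ‖(coverWeight x a ℓ i y : ℂ) * z‖ ^ 2 ≤ ‖z‖ ^ 2 := by
    calc _ ≤ ∑ i, coverWeight x a ℓ i y * ‖z‖ ^ 2 := by
          refine Finset.sum_le_sum fun i _ => ?_
          rw [norm_mul, Complex.norm_real, Real.norm_of_nonneg (coverWeight_nonneg i y), mul_pow]
          have h0 := coverWeight_nonneg (x := x) (a := a) (ℓ := ℓ) i y
          have h1 := coverWeight_le_one (x := x) (a := a) (ℓ := ℓ) i y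
          gcongr
          nlinarith
      _ = (∑ i, coverWeight x a ℓ i y) * ‖z‖ ^ 2 := by rw [Finset.sum_mul]
      _ ≤ 1 * ‖z‖ ^ 2 := by gcongr; exact sum_coverWeight_le_one y
      _ = _ := one_mul _
  have h2 := ENNReal.ofReal_le_ofReal h1
  rw [ENNReal.ofReal_sum_of_nonneg fun _ _ => by positivity] at h2
  simpa only [ENNReal.ofReal_pow (norm_nonneg _), ofReal_norm] using h2

/-- The partition of unity lets U be split among overlapping intervals; translating them all to [0,
ℓ] exhibits the integral as an average over t of discrete sums. -/
theorem integral_exp_mul_eq_sum {U : ℝ → ℂ} (hU : Integrable U)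
    (hsupp : ∀ y, y ∉ ⋃ i, Set.Icc (x i + a) (x i + a + ℓ) → U y = 0) (ξ : ℝ) :
    ∫ y : ℝ, Complex.exp ((-(h⁻¹ * ξ * y) : ℝ) * Complex.I) * U y =
      ∫ t in Set.Icc 0 ℓ, ∑ j, Complex.exp ((-(h⁻¹ * ξ * (x j + (a + t))) : ℝ) * Complex.I) *
        ((coverWeight x a ℓ j (x j + (a + t)) : ℂ) * U (x j + (a + t))) := by
  set G : ι → ℝ → ℂ := fun j y => Complex.exp ((-(h⁻¹ * ξ * y) : ℝ) * Complex.I) *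
    ((coverWeight x a ℓ j y : ℂ) * U y) with hG
  have hGi : ∀ j, Integrable (G j) := by
    intro j
    have h1 : Integrable fun y => ((coverWeight x a ℓ j y : ℂ) * U y) := by
      refine hU.bdd_mul (c := 1) ?_ ?_
      · exact (Complex.measurable_ofReal.comp (measurable_coverWeight j)).aestronglyMeasurable
      · refine Filter.Eventually.of_forall fun y => ?_
        rw [Complex.norm_real, Real.norm_of_nonneg (coverWeight_nonneg j y)]
        exact coverWeight_le_one j y
    refine h1.bdd_mul (c := 1) ?_ ?_
    · exact (by fun_prop : Continuous fun y : ℝ =>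
        Complex.exp ((-(h⁻¹ * ξ * y) : ℝ) * Complex.I)).aestronglyMeasurable
    · exact Filter.Eventually.of_forall fun y => (Complex.norm_exp_ofReal_mul_I _).le
  have e1 : ∀ y, Complex.exp ((-(h⁻¹ * ξ * y) : ℝ) * Complex.I) * U y = ∑ j, G j y := by
    intro y
    simp only [hG, ← Finset.mul_sum, ← Finset.sum_mul, ← Complex.ofReal_sum]
    by_cases hy : y ∈ ⋃ i, Set.Icc (x i + a) (x i + a + ℓ)
    · rw [sum_coverWeight hy]; simp
    · rw [hsupp y hy]; simp
  have e2 : ∀ j, ∫ y, G j y = ∫ t in Set.Icc 0 ℓ, G j (x j + (a + t)) := by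
    intro j
    rw [← integral_add_left_eq_self (G j) (x j + a), ← integral_indicator measurableSet_Icc]
    refine integral_congr_ae (Filter.Eventually.of_forall fun t => ?_)
    dsimp only
    by_cases ht : t ∈ Set.Icc 0 ℓ
    · rw [Set.indicator_of_mem ht, add_assoc]
    · rw [Set.indicator_of_notMem ht, hG]
      dsimp only
      rw [coverWeight_of_notMem]
      · simp
      · rintro ⟨h1, h2⟩
        exact ht ⟨by linarith, by linarith⟩
  simp only [e1]
  rw [integral_finsetSum _ fun j _ => hGi j, integral_finsetSum _ fun j _ => ?_]
  · exact Finset.sum_congr rfl fun j _ => e2 j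
  · have := (hGi j).comp_add_left (x j + a)
    simp only [add_assoc] at this
    exact this.integrableOn

/-- Cauchy–Schwarz in t costs a factor ℓ, and the discrete bound is used for each fixed t. The
overlap of the intervals costs nothing because the weights are nonnegative and sum to at most 1. -/
theorem sum_enorm_semiclassicalFourier_sq_le (hE0 : 0 ≤ E)
    (hE : ∀ v : ι → ℂ, ∑ i, ‖∑ j, Complex.exp ((-(h⁻¹ * x i * x j) : ℝ) * Complex.I) * v j‖ ^ 2 ≤
      E ^ 2 * ∑ j, ‖v j‖ ^ 2) {U : ℝ → ℂ} (hUm : Measurable U) (hU : Integrable U)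
    (hsupp : ∀ y, y ∉ ⋃ i, Set.Icc (x i + a) (x i + a + ℓ) → U y = 0) (s : ℝ) :
    ∑ i, ‖semiclassicalFourier h U (x i + s)‖ₑ ^ 2 ≤
      ENNReal.ofReal (1 / Real.sqrt (2 * Real.pi * h)) ^ 2 * (ENNReal.ofReal ℓ *
        (ENNReal.ofReal E ^ 2 * ∫⁻ y, ‖U y‖ₑ ^ 2)) := by
  have hc : ‖((1 / Real.sqrt (2 * Real.pi * h) : ℝ) : ℂ)‖ₑ =
      ENNReal.ofReal (1 / Real.sqrt (2 * Real.pi * h)) := by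
    rw [← ofReal_norm, Complex.norm_real, Real.norm_of_nonneg (by positivity)]
  set f : ι → ℝ → ℂ := fun j y => (coverWeight x a ℓ j y : ℂ) * U y with hf
  have hfm : ∀ j, Measurable (f j) := fun j =>
    (Complex.measurable_ofReal.comp (measurable_coverWeight j)).mul hUm
  simp only [semiclassicalFourier_eq, integral_exp_mul_eq_sum hU hsupp, enorm_mul, hc, mul_pow,
    ← Finset.mul_sum]
  gcongr
  calc _ ≤ ∑ i, ENNReal.ofReal ℓ * ∫⁻ t in Set.Icc 0 ℓ, ‖∑ j,
        Complex.exp ((-(h⁻¹ * (x i + s) * (x j + (a + t))) : ℝ) * Complex.I) *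
          f j (x j + (a + t))‖ₑ ^ 2 := by
        refine Finset.sum_le_sum fun i _ => enorm_setIntegral_sq_le ?_
        refine Finset.measurable_sum _ fun j _ => Measurable.mul ?_ ((hfm j).comp (by fun_prop))
        exact (by fun_prop : Continuous fun t : ℝ =>
          Complex.exp ((-(h⁻¹ * (x i + s) * (x j + (a + t))) : ℝ) * Complex.I)).measurable
    _ ≤ ENNReal.ofReal ℓ * ∫⁻ t in Set.Icc 0 ℓ, ∑ i, ‖∑ j,
        Complex.exp ((-(h⁻¹ * (x i + s) * (x j + (a + t))) : ℝ) * Complex.I) *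
          f j (x j + (a + t))‖ₑ ^ 2 := by
        rw [← Finset.mul_sum]
        gcongr
        exact sum_lintegral_le _ _ _
    _ ≤ ENNReal.ofReal ℓ * ∫⁻ t in Set.Icc 0 ℓ, ENNReal.ofReal E ^ 2 *
          ∑ j, ‖f j (x j + (a + t))‖ₑ ^ 2 := by
        gcongr with t
        exact sum_enorm_sq_exp_le hE0 hE s (a + t) fun j => f j (x j + (a + t))
    _ ≤ ENNReal.ofReal ℓ * ∫⁻ t, ENNReal.ofReal E ^ 2 *
          ∑ j, ‖f j (x j + (a + t))‖ₑ ^ 2 := by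
        gcongr
        exact Measure.restrict_le_self
    _ = ENNReal.ofReal ℓ * (ENNReal.ofReal E ^ 2 * ∑ j, ∫⁻ y, ‖f j y‖ₑ ^ 2) := by
        have hm : ∀ j, Measurable fun t => ‖f j (x j + (a + t))‖ₑ ^ 2 := fun j =>
          ((hfm j).comp (by fun_prop)).enorm.pow_const 2
        rw [lintegral_const_mul _ (Finset.measurable_sum _ fun j _ => hm j),
          lintegral_finsetSum _ fun j _ => hm j]
        congr 3
        funext j
        rw [← lintegral_add_left_eq_self (fun y => ‖f j y‖ₑ ^ 2) (x j + a)]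
        simp only [add_assoc]
    _ ≤ ENNReal.ofReal ℓ * (ENNReal.ofReal E ^ 2 * ∫⁻ y, ∑ j, ‖f j y‖ₑ ^ 2) := by
        gcongr
        exact sum_lintegral_le _ _ _
    _ ≤ _ := by
        gcongr with y
        exact sum_enorm_coverWeight_mul_sq_le y (U y)

theorem lintegral_localizedFourier_sq_le (hE0 : 0 ≤ E) {X : Set ℝ} (hX : MeasurableSet X)
    (hcov : X ⊆ ⋃ i, Set.Icc (x i + a) (x i + a + ℓ))
    (hE : ∀ v : ι → ℂ, ∑ i, ‖∑ j, Complex.exp ((-(h⁻¹ * x i * x j) : ℝ) * Complex.I) * v j‖ ^ 2 ≤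
      E ^ 2 * ∑ j, ‖v j‖ ^ 2) {u : ℝ → ℂ} (hum : Measurable u) (hu : MemLp u 2) :
    ∫⁻ ξ, ‖localizedFourier h X X u ξ‖ₑ ^ 2 ≤
      (ENNReal.ofReal (1 / Real.sqrt (2 * Real.pi * h)) * ENNReal.ofReal ℓ * ENNReal.ofReal E) ^ 2 *
        ∫⁻ y, ‖u y‖ₑ ^ 2 := by
  set U := X.indicator u with hUdef
  have hUm : Measurable U := hum.indicator hX
  have hXfin : volume X < ∞ := by
    refine (measure_mono hcov).trans_lt ((measure_iUnion_le _).trans_lt ?_)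
    rw [tsum_fintype]
    exact ENNReal.sum_lt_top.2 fun i _ => by rw [Real.volume_Icc]; exact ENNReal.ofReal_lt_top
  have hUi : Integrable U := by
    have : IsFiniteMeasure (volume.restrict X) := ⟨by simpa using hXfin⟩
    exact (integrable_indicator_iff hX).2 ((hu.restrict X).integrable one_le_two)
  have hsupp : ∀ y, y ∉ ⋃ i, Set.Icc (x i + a) (x i + a + ℓ) → U y = 0 := fun y hy =>
    Set.indicator_of_notMem (fun h => hy (hcov h)) _
  set F := semiclassicalFourier h U with hF
  have hind : ∀ ξ, ‖localizedFourier h X X u ξ‖ₑ ^ 2 = X.indicator (fun ξ => ‖F ξ‖ₑ ^ 2) ξ := by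
    intro ξ
    unfold localizedFourier
    by_cases hξ : ξ ∈ X
    · rw [Set.indicator_of_mem hξ, Set.indicator_of_mem hξ]
    · rw [Set.indicator_of_notMem hξ, Set.indicator_of_notMem hξ]; simp
  simp only [hind]
  rw [lintegral_indicator hX]
  calc _ ≤ ∫⁻ ξ in ⋃ i, Set.Icc (x i + a) (x i + a + ℓ), ‖F ξ‖ₑ ^ 2 := lintegral_mono_set hcov
    _ ≤ ∑ i, ∫⁻ ξ in Set.Icc (x i + a) (x i + a + ℓ), ‖F ξ‖ₑ ^ 2 := by
        refine (lintegral_iUnion_le _ _).trans ?_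
        rw [tsum_fintype]
    _ = ∑ i, ∫⁻ s in Set.Icc 0 ℓ, ‖F (x i + (a + s))‖ₑ ^ 2 := by
        simp only [setLIntegral_Icc_add]
        simp only [add_assoc]
    _ ≤ ∫⁻ s in Set.Icc 0 ℓ, ∑ i, ‖F (x i + (a + s))‖ₑ ^ 2 := sum_lintegral_le _ _ _
    _ ≤ ∫⁻ _ in Set.Icc 0 ℓ, ENNReal.ofReal (1 / Real.sqrt (2 * Real.pi * h)) ^ 2 *
          (ENNReal.ofReal ℓ * (ENNReal.ofReal E ^ 2 * ∫⁻ y, ‖U y‖ₑ ^ 2)) :=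
        lintegral_mono fun s =>
          sum_enorm_semiclassicalFourier_sq_le hE0 hE hUm hUi hsupp (a + s)
    _ ≤ ENNReal.ofReal (1 / Real.sqrt (2 * Real.pi * h)) ^ 2 *
          (ENNReal.ofReal ℓ * (ENNReal.ofReal E ^ 2 * ∫⁻ y, ‖u y‖ₑ ^ 2)) * ENNReal.ofReal ℓ := by
        rw [lintegral_const, Measure.restrict_apply_univ, Real.volume_Icc, sub_zero]
        gcongr with y
        rw [hUdef]
        exact enorm_indicator_le_enorm_self _ _
    _ = _ := by ring

theorem l2OpNorm_localizedFourier_le (hE0 : 0 ≤ E) (hℓ : 0 ≤ ℓ) {X : Set ℝ} (hX : MeasurableSet X)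
    (hcov : X ⊆ ⋃ i, Set.Icc (x i + a) (x i + a + ℓ))
    (hE : ∀ v : ι → ℂ, ∑ i, ‖∑ j, Complex.exp ((-(h⁻¹ * x i * x j) : ℝ) * Complex.I) * v j‖ ^ 2 ≤
      E ^ 2 * ∑ j, ‖v j‖ ^ 2) :
    l2OpNorm (localizedFourier h X X) ≤
      ENNReal.ofReal (1 / Real.sqrt (2 * Real.pi * h) * ℓ * E) := by
  refine sInf_le fun u hu => ?_
  -- Passing to a measurable representative changes neither norm, since the transform is an
  -- integral.
  obtain ⟨u', hu'm, huu'⟩ := hu.1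
  have hT : localizedFourier h X X u = localizedFourier h X X u' := by
    unfold localizedFourier
    congr 1
    funext ξ
    unfold semiclassicalFourier
    congr 1
    refine integral_congr_ae ?_
    filter_upwards [huu'] with y hy
    by_cases hyX : y ∈ X
    · rw [Set.indicator_of_mem hyX, Set.indicator_of_mem hyX, hy]
    · rw [Set.indicator_of_notMem hyX, Set.indicator_of_notMem hyX]
  rw [hT, eLpNorm_congr_ae huu']
  have hsq : ∀ f : ℝ → ℂ, eLpNorm f 2 volume ^ 2 = ∫⁻ y, ‖f y‖ₑ ^ 2 := by
    intro f
    have := eLpNorm_nnreal_pow_eq_lintegral (f := f) (μ := volume) (p := 2) two_ne_zero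
    norm_num at this
    exact_mod_cast this
  have h1 := lintegral_localizedFourier_sq_le hE0 hX hcov hE hu'm.measurable
    ((memLp_congr_ae huu').1 hu)
  rw [← hsq, ← hsq, ← mul_pow] at h1
  rw [ENNReal.ofReal_mul (by positivity), ENNReal.ofReal_mul (by positivity)]
  exact le_of_not_gt fun hlt => absurd h1 (not_le.2 (ENNReal.pow_lt_pow_left two_ne_zero hlt))

end Covering

/-! ### Choice of scales and constants. -/

namespace RandomCantor

/-- An interval of generation n has length at most h; enlarging it by 2h on each side covers the
closed h-neighbourhood and gives the length 5h. -/
theorem cthickening_cantorSet_subset {M A n : ℕ} (ω : Sample M A) {h : ℝ} (hn : 1 ≤ n)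
    (hh : 0 < h) (hMh : 1 / (M : ℝ) ^ n ≤ h) :
    Metric.cthickening h (cantorSet ω) ⊆
      ⋃ w, Set.Icc (point ω n w + -(2 * h)) (point ω n w + -(2 * h) + 5 * h) := by
  intro x hx
  have hx' := Metric.cthickening_subset_thickening' (by linarith : (0 : ℝ) < 2 * h)
    (by linarith) _ hx
  obtain ⟨y, hy, hxy⟩ := Metric.mem_thickening_iff.1 hx'
  have hy' : y ∈ cantorStage ω n := by
    simp only [cantorSet, Set.mem_iInter] at hy
    exact hy n hn
  simp only [cantorStage, leftEndpoints, Set.mem_iUnion, Set.mem_range] at hy'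
  obtain ⟨b, ⟨w, rfl⟩, hb⟩ := hy'
  rw [Real.dist_eq, abs_lt] at hxy
  refine Set.mem_iUnion.2 ⟨w, ?_, ?_⟩ <;> linarith [hb.1, hb.2, hxy.1, hxy.2]

theorem l2OpNorm_localizedFourier_cantorSet_le {M A p k q : ℕ} {ω : Sample M A} {h : ℝ}
    (hM : 0 < M) (hA : 0 < A) (hk : 0 < k) (hkp : k ≤ p) (hω : ω ∉ badSet M A p k q)
    (hh : 0 < h) (hT : (M : ℝ) ^ (p + k) ≤ M * h⁻¹) (hT' : h⁻¹ ≤ (M : ℝ) ^ (p + k)) :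
    l2OpNorm (localizedFourier h (Metric.cthickening h (cantorSet ω))
        (Metric.cthickening h (cantorSet ω)))
      ≤ ENNReal.ofReal (1 / √(2 * Real.pi * h) * (5 * h) *
          (Real.exp 3 * treeBound M A p q k)) := by
  have htree : 0 ≤ treeBound M A p q k :=
    mul_nonneg (by positivity) (gridBound_pos hA p).le
  refine l2OpNorm_localizedFourier_le (by positivity) (by positivity)
    Metric.isClosed_cthickening.measurableSet
    (cthickening_cantorSet_subset (n := p + k) ω (by omega) hh ?_)
    (sum_norm_sq_exp_point_le hM hA hk hkp hω hT hT')
  rw [one_div]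
  exact inv_le_of_inv_le₀ hh hT'

theorem prefactor_le {h : ℝ} (hh : 0 < h) : 1 / √(2 * Real.pi * h) * (5 * h) ≤ 2 * √h := by
  rw [Real.sqrt_mul (by positivity)]
  have h1 : (5 / 2 : ℝ) ≤ √(2 * Real.pi) := by
    apply Real.le_sqrt_of_sq_le
    nlinarith [Real.pi_gt_d2]
  have h2 : 0 < √h := Real.sqrt_pos.2 hh
  rw [one_div_mul_eq_div, div_le_iff₀ (by positivity)]
  nlinarith [Real.mul_self_sqrt hh.le]

/-- Here X stands for M^ε. All losses are at most exponential in m with the fixed base 48 = 12 · 2 ·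
2, apart from two factors X, so X ≥ 1000 and m ≥ 8 absorb them. -/
theorem combinatorial_factor_le {m k p : ℕ} {X L Θ : ℝ} (hm : 8 ≤ m) (hk : k + 1 ≤ m)
    (hp : p ≤ m) (hX : 1000 ≤ X) (hL0 : 0 ≤ L) (hL : L ≤ X) (hΘ0 : 0 ≤ Θ) (hΘ : Θ ≤ 2 * X) :
    12 ^ (k + 1) * ((m + 1) * Θ) * (48 * (1 + p * L)) ≤ X ^ m := by
  have hX0 : 0 < X := by linarith
  have h12 : (12 : ℝ) ^ (k + 1) ≤ 12 ^ m := pow_le_pow_right₀ (by norm_num) hk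
  have hpm : (p : ℝ) ≤ m := by exact_mod_cast hp
  have h1 : 1 + p * L ≤ (m + 1) * X := by nlinarith [mul_le_mul hpm hL hL0 (by positivity)]
  have h2 : (m + 1 : ℝ) ≤ 2 ^ m := by exact_mod_cast Nat.lt_two_pow_self (n := m)
  obtain ⟨j, rfl⟩ := Nat.exists_eq_add_of_le hm
  have h3 : (48 : ℝ) ^ j ≤ X ^ j := pow_le_pow_left₀ (by norm_num) (by linarith) _
  have h4 : (96 * 48 ^ 8 : ℝ) ≤ X ^ 6 :=
    le_trans (by norm_num) (pow_le_pow_left₀ (by norm_num) hX 6)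
  calc 12 ^ (k + 1) * (((8 + j : ℕ) + 1) * Θ) * (48 * (1 + p * L))
      ≤ 12 ^ (8 + j) * (2 ^ (8 + j) * (2 * X)) * (48 * (2 ^ (8 + j) * X)) := by
        gcongr
        exact h1.trans (by gcongr)
    _ = (96 * 48 ^ 8) * 48 ^ j * X ^ 2 := by
        have : (48 : ℝ) ^ j = 12 ^ j * 2 ^ j * 2 ^ j := by
          rw [← mul_pow, ← mul_pow]; norm_num
        rw [this]; ring
    _ ≤ X ^ 6 * X ^ j * X ^ 2 := by gcongr
    _ = X ^ (8 + j) := by ring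

/-- The exponent 3/4 comes from p + 1: for p = ⌈(m+1)/2⌉ it is at most m/2 + 2, hence at most 3m/4
once m ≥ 8. All remaining factors go into (M^ε)^m. -/
theorem treeBound_le {M A m k p Θ : ℕ} {δ ε : ℝ} (hM : 1 ≤ M) (hδ : 0 < δ)
    (hAM : (A : ℝ) = (M : ℝ) ^ δ) (hm : 8 ≤ m) (hk : k + 1 ≤ m) (hp : 4 * (p + 1) ≤ 3 * m)
    (hX : 1000 ≤ (M : ℝ) ^ ε) (hL : Real.log M ≤ (M : ℝ) ^ ε) (hΘ : (Θ : ℝ) ≤ 2 * (M : ℝ) ^ ε) :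
    treeBound M A p ((m + 1) * Θ) k ≤ ((M : ℝ) ^ m) ^ (3 / 4 * δ + ε) := by
  have hM' : (1 : ℝ) ≤ M := by exact_mod_cast hM
  have hM0 : (0 : ℝ) < M := by linarith
  have hpm : (4 * (p + 1) : ℝ) ≤ 3 * m := by exact_mod_cast hp
  have hA : (A : ℝ) ^ (p + 1) ≤ (M : ℝ) ^ (m * (3 / 4 * δ)) := by
    rw [hAM, ← Real.rpow_natCast, ← Real.rpow_mul hM0.le]
    refine Real.rpow_le_rpow_of_exponent_le hM' ?_
    push_cast
    nlinarith
  have hc := combinatorial_factor_le (p := p) hm hk (by omega) hX (Real.log_nonneg hM') hL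
    (Nat.cast_nonneg Θ) hΘ
  have hfac : (0 : ℝ) ≤ 12 ^ (k + 1) * ((m + 1) * Θ) * (48 * (1 + p * Real.log M)) := by
    have := Real.log_nonneg hM'
    positivity
  calc treeBound M A p ((m + 1) * Θ) k
      = (A : ℝ) ^ (p + 1) * (12 ^ (k + 1) * ((m + 1) * Θ) * (48 * (1 + p * Real.log M))) := by
        simp only [treeBound, gridBound]
        push_cast
        ring
    _ ≤ (M : ℝ) ^ (m * (3 / 4 * δ)) * ((M : ℝ) ^ ε) ^ m := by gcongr
    _ = ((M : ℝ) ^ m) ^ (3 / 4 * δ + ε) := by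
        rw [← Real.rpow_natCast, ← Real.rpow_natCast, ← Real.rpow_mul hM0.le,
          ← Real.rpow_mul hM0.le, ← Real.rpow_add hM0]
        congr 1
        ring

theorem operator_bound_le {h T E δ ε : ℝ} (hh : 0 < h) (hE : T ≤ E ^ (3 / 4 * δ + ε))
    (hE0 : 0 ≤ E) (hEh : E ≤ h⁻¹) (hδε : 0 ≤ 3 / 4 * δ + ε) (hT : 0 ≤ T) :
    1 / √(2 * Real.pi * h) * (5 * h) * (Real.exp 3 * T)
      ≤ 2 * Real.exp 3 * h ^ (1 / 2 - 3 / 4 * δ - ε) := by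
  have h1 : T ≤ h ^ (-(3 / 4 * δ + ε)) := by
    rw [Real.rpow_neg hh.le, ← Real.inv_rpow hh.le]
    exact hE.trans (Real.rpow_le_rpow hE0 hEh hδε)
  calc 1 / √(2 * Real.pi * h) * (5 * h) * (Real.exp 3 * T)
      ≤ 2 * √h * (Real.exp 3 * h ^ (-(3 / 4 * δ + ε))) :=
        mul_le_mul (prefactor_le hh) (by gcongr) (by positivity) (by positivity)
    _ = 2 * Real.exp 3 * (h ^ (1 / 2 : ℝ) * h ^ (-(3 / 4 * δ + ε))) := by
        rw [Real.sqrt_eq_rpow]; ring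
    _ = 2 * Real.exp 3 * h ^ (1 / 2 - 3 / 4 * δ - ε) := by
        rw [← Real.rpow_add hh]
        congr 2
        ring

/-- The exceptional event attached to the scale `M ^ (-n)`. -/
def badScale (M A Θ n : ℕ) : Set (Sample M A) := badSet M A (n - n / 2) (n / 2) (n * Θ)

/-- The number of events and the matrix size together cost at most M^(2n), because A ≤ M and 2k ≤
M^k. The choice q = nΘ gives the gain 2^(-nΘ). -/
theorem sampleMeasure_badScale_le {M A Θ n : ℕ} (hM : 2 ≤ M) (hA : 0 < A) (hAM : A ≤ M)
    (hΘ : 0 < Θ) (hn : 8 ≤ n) :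
    sampleMeasure M A (badScale M A Θ n) ≤ ENNReal.ofReal (((M : ℝ) ^ 2 / 2 ^ Θ) ^ n) := by
  refine (sampleMeasure_badSet_le (by omega) hA hAM (by positivity) (by omega)).trans
    (ENNReal.ofReal_le_ofReal ?_)
  obtain ⟨p, hp⟩ : ∃ p, n - n / 2 = p := ⟨_, rfl⟩
  obtain ⟨k, hk⟩ : ∃ k, n / 2 = k := ⟨_, rfl⟩
  have hn' : n = p + k := by omega
  have hk4 : 4 ≤ k := by omega
  rw [hp, hk]
  clear hp hk
  have hM' : (2 : ℝ) ≤ M := by exact_mod_cast hM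
  have hA' : (A : ℝ) ≤ M := by exact_mod_cast hAM
  have h2k : (2 * k : ℝ) ≤ M ^ k := by
    refine le_trans ?_ (pow_le_pow_left₀ (by norm_num) hM' k)
    obtain ⟨i, rfl⟩ : ∃ i, k = i + 1 := ⟨k - 1, by omega⟩
    rw [pow_succ, mul_comm]
    gcongr
    exact_mod_cast Nat.lt_two_pow_self (n := i)
  have h1 : (M : ℝ) ^ k + 1 ≤ 2 * M ^ k := by
    linarith [one_le_pow₀ (by linarith : (1 : ℝ) ≤ M) (n := k)]
  calc (A : ℝ) ^ p * (M ^ k + 1) * k * (A ^ p / 2 ^ (n * Θ))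
      ≤ (M : ℝ) ^ p * (2 * M ^ k) * k * (M ^ p / 2 ^ (n * Θ)) := by gcongr
    _ = (M : ℝ) ^ p * M ^ k * (2 * k) * (M ^ p / 2 ^ (n * Θ)) := by ring
    _ ≤ (M : ℝ) ^ p * M ^ k * M ^ k * (M ^ p / 2 ^ (n * Θ)) := by gcongr
    _ = ((M : ℝ) ^ 2 / 2 ^ Θ) ^ n := by
        rw [div_pow, ← pow_mul 2 Θ n, mul_comm Θ n, hn']; ring

/-- The ratio r is at most exp(X/4 - X/2). Eight of the at least nine factors give exp(-X), and the
others give a geometric series of sum at most 1. -/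
theorem sampleMeasure_iUnion_badScale_le {M A Θ : ℕ} {X : ℝ} (hM : 2 ≤ M) (hA : 0 < A)
    (hAM : A ≤ M) (hX : 1000 ≤ X) (hΘ : X ≤ Θ) (hL : 8 * Real.log M ≤ X) :
    sampleMeasure M A (⋃ i, badScale M A Θ (i + 9)) ≤ ENNReal.ofReal (Real.exp (-X)) := by
  have hM0 : (0 : ℝ) < M := by positivity
  have hΘ0 : 0 < Θ := by
    have : (0 : ℝ) < Θ := by linarith
    exact_mod_cast this
  set r : ℝ := (M : ℝ) ^ 2 / 2 ^ Θ with hr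
  have hr0 : 0 ≤ r := by positivity
  have hrX : r ≤ Real.exp (-(X / 4)) := by
    rw [hr, div_le_iff₀ (by positivity)]
    have h1 : Real.exp (X / 2) ≤ 2 ^ Θ := by
      have : (2 : ℝ) ^ Θ = Real.exp (Θ * Real.log 2) := by
        rw [Real.exp_nat_mul, Real.exp_log two_pos]
      rw [this]
      refine Real.exp_le_exp.2 ?_
      nlinarith [Real.log_two_gt_d9]
    have h2 : (M : ℝ) ^ 2 ≤ Real.exp (X / 4) := by
      have : (M : ℝ) ^ 2 = Real.exp ((2 : ℕ) * Real.log M) := by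
        rw [Real.exp_nat_mul, Real.exp_log hM0]
      rw [this]
      refine Real.exp_le_exp.2 ?_
      push_cast
      linarith
    calc (M : ℝ) ^ 2 ≤ Real.exp (X / 4) := h2
      _ = Real.exp (-(X / 4)) * Real.exp (X / 2) := by
          rw [← Real.exp_add]; congr 1; ring
      _ ≤ _ := by gcongr
  have hr8 : r ^ 8 ≤ Real.exp (-X) := by
    refine (pow_le_pow_left₀ hr0 hrX 8).trans ?_
    rw [← Real.exp_nat_mul]
    refine Real.exp_le_exp.2 ?_
    push_cast
    linarith
  have hr2 : r ≤ 1 / 2 := by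
    refine hrX.trans ?_
    rw [Real.exp_neg, one_div]
    refine inv_anti₀ two_pos ?_
    linarith [Real.add_one_le_exp (X / 4)]
  have hterm : ∀ i : ℕ, r ^ (i + 9) ≤ Real.exp (-X) / 2 / 2 ^ i := by
    intro i
    calc r ^ (i + 9) = r ^ 8 * r * r ^ i := by ring
      _ ≤ Real.exp (-X) * (1 / 2) * (1 / 2) ^ i := by gcongr
      _ = Real.exp (-X) / 2 / 2 ^ i := by rw [one_div_pow]; ring
  calc sampleMeasure M A (⋃ i, badScale M A Θ (i + 9))
      ≤ ∑' i, sampleMeasure M A (badScale M A Θ (i + 9)) := measure_iUnion_le _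
    _ ≤ ∑' i : ℕ, ENNReal.ofReal (Real.exp (-X) / 2 / 2 ^ i) :=
        ENNReal.tsum_le_tsum fun i =>
          (sampleMeasure_badScale_le hM hA hAM hΘ0 (by omega)).trans
            (ENNReal.ofReal_le_ofReal (hterm i))
    _ = ENNReal.ofReal (Real.exp (-X)) := by
        rw [← ENNReal.ofReal_tsum_of_nonneg (fun i => by positivity)
          (summable_geometric_two' _), tsum_geometric_two']

theorem l2OpNorm_le_of_notMem_badScale {M A Θ : ℕ} {δ ε h : ℝ} {ω : Sample M A} (hM : 2 ≤ M)
    (hA : 0 < A) (hδ : 0 < δ) (hε : 0 < ε) (hAM : (A : ℝ) = (M : ℝ) ^ δ)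
    (hX : 1000 ≤ (M : ℝ) ^ ε) (hL : Real.log M ≤ (M : ℝ) ^ ε) (hΘ : (Θ : ℝ) ≤ 2 * (M : ℝ) ^ ε)
    (hω : ∀ i, ω ∉ badScale M A Θ (i + 9)) (hh : 0 < h) (hhM : h < (M : ℝ) ^ (-8 : ℝ)) :
    l2OpNorm (localizedFourier h (Metric.cthickening h (cantorSet ω))
        (Metric.cthickening h (cantorSet ω)))
      ≤ ENNReal.ofReal (2 * Real.exp 3 * h ^ (1 / 2 - 3 / 4 * δ - ε)) := by
  have hM1 : (1 : ℝ) < M := by exact_mod_cast hM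
  have hM0 : (0 : ℝ) < M := by linarith
  have h8 : (M : ℝ) ^ 8 < h⁻¹ := by
    rw [Real.rpow_neg hM0.le] at hhM
    have h1 := (lt_inv_comm₀ hh (by positivity)).1 hhM
    exact_mod_cast h1
  -- The scale used is n = m + 1, where M^m ≤ 1/h < M^(m+1); the condition h < M^(-8) means m ≥ 8,
  -- so only n ≥ 9 occurs.
  obtain ⟨m, hm, hm'⟩ := exists_nat_pow_near ((one_le_pow₀ hM1.le).trans h8.le) hM1
  have hm8 : 8 ≤ m := by
    have := (pow_lt_pow_iff_right₀ hM1).1 (h8.trans hm')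
    omega
  obtain ⟨i, rfl⟩ := Nat.exists_eq_add_of_le' hm8
  have hsum : (i + 9) - (i + 9) / 2 + (i + 9) / 2 = i + 8 + 1 := by omega
  have htree := treeBound_le (k := (i + 9) / 2) (p := (i + 9) - (i + 9) / 2) (by omega) hδ hAM
    hm8 (by omega) (by omega) hX hL hΘ
  refine (l2OpNorm_localizedFourier_cantorSet_le (by omega) hA (by omega) (by omega) (hω i) hh
    ?_ ?_).trans (ENNReal.ofReal_le_ofReal (operator_bound_le hh htree (by positivity) hm
      (by positivity) ?_))
  · rw [hsum, pow_succ, mul_comm]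
    gcongr
  · rw [hsum]
    exact hm'.le
  · exact mul_nonneg (by positivity) (gridBound_pos hA _).le

end RandomCantor

/-! ### The main theorem. -/

open Filter in
theorem exists_scale_threshold {ε : ℝ} (hε : 0 < ε) :
    ∃ N : ℝ, 2 ≤ N ∧ ∀ x : ℝ, N ≤ x → 1000 ≤ x ^ ε ∧ 8 * Real.log x ≤ x ^ ε := by
  have h1 := (tendsto_rpow_atTop hε).eventually_ge_atTop 1000
  have h2 := (isLittleO_log_rpow_atTop hε).bound (by norm_num : (0 : ℝ) < 1 / 8)
  obtain ⟨N, hN⟩ := eventually_atTop.1 (h1.and h2)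
  refine ⟨max N 2, le_max_right _ _, fun x hx => ?_⟩
  obtain ⟨ha, hb⟩ := hN x ((le_max_left _ _).trans hx)
  refine ⟨ha, ?_⟩
  rw [Real.norm_eq_abs, Real.norm_eq_abs, abs_of_nonneg (by linarith : 0 ≤ x ^ ε)] at hb
  linarith [le_abs_self (Real.log x)]

theorem theorem1p1 :
    ∃ C : ℝ, 0 < C ∧ ∀ ε : ℝ, 0 < ε → ∃ C₁ : ℝ, 0 < C₁ ∧
      ∀ δ : ℝ, 0 < δ → δ < 2 / 3 → ε < δ / 2 →
      ∀ M A : ℕ, Real.exp (4 / δ) ≤ (M : ℝ) → (A : ℝ) = (M : ℝ) ^ δ →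
        ∃ G : Set (RandomCantor.Sample M A), MeasurableSet G ∧
          RandomCantor.sampleMeasure M A Gᶜ
            ≤ ENNReal.ofReal (C₁ * Real.exp (-((M : ℝ) ^ ε / C))) ∧
          ∀ ω ∈ G, ∀ h : ℝ, 0 < h → h < (M : ℝ) ^ (-8 : ℝ) →
            l2OpNorm (localizedFourier h
                (Metric.cthickening h (RandomCantor.cantorSet ω))
                (Metric.cthickening h (RandomCantor.cantorSet ω)))
              ≤ ENNReal.ofReal (C * h ^ (1 / 2 - 3 / 4 * δ - ε)) := by
  have hC : 1 ≤ 2 * Real.exp 3 := by linarith [Real.add_one_le_exp (3 : ℝ)]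
  refine ⟨2 * Real.exp 3, by positivity, fun ε hε => ?_⟩
  obtain ⟨N, hN2, hN⟩ := exists_scale_threshold hε
  -- For M below the threshold N this constant makes the probability bound at least 1, so the empty
  -- set of good samples suffices there.
  refine ⟨Real.exp (N ^ ε), Real.exp_pos _, fun δ hδ hδ' _ M A hMδ hAM => ?_⟩
  have hM1 : (1 : ℝ) < M := (Real.one_lt_exp_iff.2 (by positivity)).trans_le hMδ
  have hM2 : 2 ≤ M := by exact_mod_cast hM1
  have hM0 : (0 : ℝ) < M := by linarith
  have hA0 : 0 < A := by
    have : (0 : ℝ) < A := hAM ▸ Real.rpow_pos_of_pos hM0 δ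
    exact_mod_cast this
  have hAleM : A ≤ M := by
    have : (A : ℝ) ≤ M := by
      rw [hAM]
      exact (Real.rpow_le_rpow_of_exponent_le hM1.le (by linarith)).trans_eq (Real.rpow_one _)
    exact_mod_cast this
  have hX0 : 0 ≤ (M : ℝ) ^ ε := by positivity
  have hXC : (M : ℝ) ^ ε / (2 * Real.exp 3) ≤ (M : ℝ) ^ ε := div_le_self hX0 hC
  have := RandomCantor.isProbabilityMeasure_sampleMeasure hAleM
  rcases lt_or_ge (M : ℝ) N with hMN | hMN
  · refine ⟨∅, MeasurableSet.empty, ?_, fun ω hω => absurd hω (Set.notMem_empty ω)⟩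
    refine prob_le_one.trans (ENNReal.one_le_ofReal.2 ?_)
    rw [← Real.exp_add]
    refine Real.one_le_exp ?_
    linarith [Real.rpow_le_rpow hM0.le hMN.le hε.le]
  · obtain ⟨hX, hL⟩ := hN M hMN
    have hlog := Real.log_nonneg hM1.le
    -- The good samples avoid the bad events of all scales n ≥ 9 at once, with Θ = ⌈M^ε⌉.
    refine ⟨(⋃ i, RandomCantor.badScale M A ⌈(M : ℝ) ^ ε⌉₊ (i + 9))ᶜ,
      (MeasurableSet.iUnion fun i => RandomCantor.measurableSet_badSet _ _ _).compl, ?_,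
      fun ω hω h hh hhM => ?_⟩
    · rw [compl_compl]
      refine (RandomCantor.sampleMeasure_iUnion_badScale_le hM2 hA0 hAleM hX (Nat.le_ceil _)
        hL).trans (ENNReal.ofReal_le_ofReal ?_)
      rw [← Real.exp_add]
      refine Real.exp_le_exp.2 ?_
      linarith [Real.rpow_nonneg (by linarith : (0 : ℝ) ≤ N) ε]
    · refine RandomCantor.l2OpNorm_le_of_notMem_badScale hM2 hA0 hδ hε hAM hX (by linarith) ?_
        (by simpa using hω) hh hhM
      linarith [Nat.ceil_lt_add_one hX0]
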